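/- Let $H\in(0,1)$ and let $B=(B_t)_{t\ge 0}$ be a fractional Brownian motion with Hurst parameter $H$, i.e. a centered Gaussian process with continuous paths and $\mathbb E[B_sB_t]=\tfrac12\big(t^{2H}+s^{2H}-|t-s|^{2H}\big)$. Let $\sigma\in C^\infty(\mathbb R)$ have bounded derivatives of all orders $n\ge 1$, and let $x_0\in\mathbb R$ with $\sigma(x_0)\neq 0$. Let $X=(X_t)_{t\ge0}$ be a pathwise solution of $dX_t=\sigma(X_t)\circ dB_t$, $X_0=x_0$, in the sense of Newton–Cotes functionals: there is $f\in C^\infty(\mathbb R)$ such that, for every $t\ge 0$, $X_t=f(B_t)$ almost surely, and for every integer $m\ge1$ with $H>\frac1{4m+2}$ and every $t\ge0$, $$X_t=x_0+\lim_{\varepsilon\downarrow0}\frac1\varepsilon\int_0^t\Big(\int_{[0,1]}\sigma\big(f(B_s+\alpha(B_{s+\varepsilon}-B_s))\big)\,\nu_m(d\alpha)\Big)(B_{s+\varepsilon}-B_s)\,ds\quad\text{(limit in probability)},$$ where $\nu_1=\frac12(\delta_0+\delta_1)$ and $\nu_m=\sum_{j=0}^{2m-2}\Big(\int_0^1\prod_{0\le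 k\le 2m-2,\,k\ne j}\frac{(2m-2)u-k}{j-k}\,du\Big)\delta_{j/(2m-2)}$ for $m\ge2$. Then for every $t>0$ the random variable $X_t$ has a (unique) continuous probability density $f_{X_t}$ on $\mathbb R$, which is differentiable wherever it is positive; the Shannon entropy $h(X_t)=-\int_{\mathbb R} f_{X_t}(x)\ln f_{X_t}(x)\,dx$, the generalized Fisher information $J_{\sigma^2}(X_t)=\mathbb E\big[\sigma^2(X_t)\big(\tfrac{\partial}{\partial x}\ln f_{X_t}(X_t)\big)^2\big]$ and the expectations below are well defined and finite; and $t\mapsto h(X_t)$ is differentiable on $(0,\infty)$ with $$\frac{d}{dt}h(X_t)=Ht^{2H-1}\Big\{J_{\sigma^2}(X_t)-\mathbb E\big[(\sigma^2)''(X_t)\big]+\mathbb E\big[\sigma''(X_t)\sigma(X_t)+(\sigma'(X_t))^2\big]\Big\},\qquad t>0 .$$ -/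

import Mathlib

open MeasureTheory ProbabilityTheory Filter Topology
open scoped NNReal

/-- `B` is a fractional Brownian motion with Hurst parameter `H` on `(Ω, P)`: a centered Gaussian
process on `[0, ∞)` with (almost surely) continuous paths and covariance
`E[B_s B_t] = (t^{2H} + s^{2H} - |t - s|^{2H}) / 2`. Stationarity of the increments
is a consequence of the covariance function. -/
structure IsFBM {Ω : Type*} [MeasurableSpace Ω] (P : Measure Ω) (H : ℝ)
    (B : ℝ≥0 → Ω → ℝ) : Prop where
  gaussian : IsGaussianProcess B P
  centered : ∀ t, ∫ ω, B t ω ∂P = 0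
  covariance : ∀ s t : ℝ≥0, ∫ ω, B s ω * B t ω ∂P =
    ((t : ℝ) ^ (2 * H) + (s : ℝ) ^ (2 * H) - |(t : ℝ) - (s : ℝ)| ^ (2 * H)) / 2
  continuous_paths : ∀ᵐ ω ∂P, Continuous fun t => B t ω

/-- The Newton-Cotes quadrature `∫ φ dν_m` on `[0, 1]` of order `m ≥ 1`:
`ν_1 = (δ_0 + δ_1) / 2` and, for `m ≥ 2`,
`ν_m = ∑_{j=0}^{2m-2} (∫_0^1 ∏_{k ≠ j} ((2m-2) u - k) / (j - k) du) δ_{j/(2m-2)}`. -/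
noncomputable def newtonCotes (m : ℕ) (φ : ℝ → ℝ) : ℝ :=
  if m = 1 then (φ 0 + φ 1) / 2
  else ∑ j ∈ Finset.range (2 * m - 1),
    (∫ u in (0 : ℝ)..1, ∏ k ∈ (Finset.range (2 * m - 1)).erase j,
      ((2 * (m : ℝ) - 2) * u - (k : ℝ)) / ((j : ℝ) - (k : ℝ))) *
    φ ((j : ℝ) / (2 * (m : ℝ) - 2))

/-- `I` is the `m`-order Newton-Cotes functional `∫_0^t g(B_s) d^{NC,m} B_s`, i.e. the limit in
probability, as `ε ↓ 0`, of
`ε⁻¹ ∫_0^t (∫ g(B_s + α (B_{s+ε} - B_s)) ν_m(dα)) (B_{s+ε} - B_s) ds`.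
For `m = 1` this is the symmetric (Russo-Vallois) integral. -/
def IsNewtonCotesIntegral {Ω : Type*} [MeasurableSpace Ω] (P : Measure Ω) (m : ℕ)
    (g : ℝ → ℝ) (B : ℝ≥0 → Ω → ℝ) (t : ℝ≥0) (I : Ω → ℝ) : Prop :=
  TendstoInMeasure P
    (fun (ε : ℝ) (ω : Ω) => ε⁻¹ * ∫ s in (0 : ℝ)..(t : ℝ),
      newtonCotes m (fun α => g (B s.toNNReal ω +
        α * (B (s + ε).toNNReal ω - B s.toNNReal ω))) *
      (B (s + ε).toNNReal ω - B s.toNNReal ω))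
    (𝓝[>] 0) I

/-- `X` is a pathwise solution of `dX_t = σ(X_t) ∘ dB_t`, `X_0 = x₀`, where `B` has Hurst
parameter `H` and the integral is the Newton-Cotes functional: `X_t = f(B_t)` for a smooth `f`
(the Newton-Cotes functional integrates functions of `B` against `B`), and
`X_t = x₀ + ∫_0^t σ(X_s) d^{NC,m} B_s` for every `t ≥ 0` and every admissible order `m`,
i.e. every `m ≥ 1` with `H > 1 / (4 m + 2)`. -/
def IsPathwiseSolution {Ω : Type*} [MeasurableSpace Ω] (P : Measure Ω) (H : ℝ)
    (B : ℝ≥0 → Ω → ℝ) (σ : ℝ → ℝ) (x₀ : ℝ) (X : ℝ≥0 → Ω → ℝ) : Prop :=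
  ∃ f : ℝ → ℝ, ContDiff ℝ (⊤ : ℕ∞) f ∧
    (∀ t, ∀ᵐ ω ∂P, X t ω = f (B t ω)) ∧
    ∀ m : ℕ, 1 ≤ m → 1 / (4 * (m : ℝ) + 2) < H →
      ∀ t, IsNewtonCotesIntegral P m (fun x => σ (f x)) B t (fun ω => X t ω - x₀)

/-- `f` is the continuous probability density function of the real random variable `Y`,
differentiable wherever it is positive. A continuous density is unique, so that pointwise
derivatives of `log f` are meaningful. -/
structure IsRegularDensity {Ω : Type*} [MeasurableSpace Ω] (P : Measure Ω)
    (Y : Ω → ℝ) (f : ℝ → ℝ) : Prop where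
  aemeasurable : AEMeasurable Y P
  continuous : Continuous f
  nonneg : ∀ x, 0 ≤ f x
  law : P.map Y = volume.withDensity fun x => ENNReal.ofReal (f x)
  differentiableAt : ∀ x, 0 < f x → DifferentiableAt ℝ f x

/-- The Shannon entropy `-∫ f log f` of a random variable with density `f`. -/
noncomputable def shannonEntropy (f : ℝ → ℝ) : ℝ := -∫ x, f x * Real.log (f x)

/-- The integrand `b(x) (∂ₓ log f(x))²` of the generalized Fisher information. -/
noncomputable def fisherIntegrand (b f : ℝ → ℝ) (x : ℝ) : ℝ :=
  b x * (deriv (fun y => Real.log (f y)) x) ^ 2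

/-- The generalized Fisher information `J_b(Y) = E[b(Y) (∂ₓ log f(Y))²]` of a random variable `Y`
with density `f`. -/
noncomputable def fisherInformation {Ω : Type*} [MeasurableSpace Ω] (P : Measure Ω)
    (b : ℝ → ℝ) (Y : Ω → ℝ) (f : ℝ → ℝ) : ℝ :=
  ∫ ω, fisherIntegrand b f (Y ω) ∂P

/-!
The Newton–Cotes functional of sufficiently high order integrates smooth functions of `B` by the
ordinary fundamental theorem of calculus. The quadrature rule of order `m` is exact on polynomials
of degree at most `2m - 2`, so by Taylor's formula the quadrature of `g` over the segment from `B_s`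
to `B_{s+ε}` times the increment `ΔB` equals `G(B_{s+ε}) - G(B_s)`, for a primitive `G` of `g`, up
to `O(|ΔB| ^ (2m))` (`exists_newtonCotes_increment_bound`). Since `E |ΔB| ^ (2m)` is of order
`ε ^ (2Hm)`, the remainder vanishes once `m` is large (`IsFBM.ae_tendsto_variation_zero`), and the
main term telescopes to `G(B_t) - G(B_0)` (`IsNewtonCotesIntegral.ae_eq_sub`). The equation defines
`X` with every admissible order, so `f(B_t) = x₀ + ∫_0^{B_t} σ(f)` almost surely, and as the law of
`B_1` has full support, `f` solves `f' = σ(f)`, `f(0) = x₀` (`IsPathwiseSolution.exists_flow`).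

As `σ(x₀) ≠ 0`, the speed `σ(f)` never vanishes (`speed_ne_zero`), and `L = log |σ(f)|` has the
bounded derivative `σ'(f)`, hence linear growth. So `f` is a diffeomorphism onto an open interval,
and with `v = t ^ (2H)` the law of `X_t` has density `φ_v(y) / |σ(f(y))|` at `f(y)`, where `φ_v` is
the centered Gaussian density of variance `v`, and density zero outside the range. The density is
continuous because `φ_v exp(-L)` vanishes at infinity (`isRegularDensity_flowDensity`).

In the coordinate `y` everything is a Gaussian integral. The entropy is
`log(2πv) / 2 + 1 / 2 + E[L(B_t)]` (`shannonEntropy_flowDensity`), with derivative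
`H t ^ (2H - 1) (1 / v + E[L''(B_t)])` by Gaussian integration by parts
(`hasDerivAt_integral_comp_mul_gaussianReal`). The Fisher information is `E[(B_t / v + L'(B_t))²]`
(`fisherIntegrand_flowDensity`), which equals `1 / v + 2 E[L''(B_t)] + E[L'(B_t)²]`, again by
integration by parts. Since `L'' = (σ''σ)(f)` and `L' = σ'(f)`, the two sides of the identity agree.
-/

/-! ### Newton–Cotes quadrature -/

theorem newtonCotes_eval_polynomial {m : ℕ} (hm : 2 ≤ m) {q : Polynomial ℝ}
    (hq : q.degree < ((2 * m - 1 : ℕ) : WithBot ℕ)) :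
    newtonCotes m (fun u => q.eval u) = ∫ u in (0 : ℝ)..1, q.eval u := by
  have hm' : (2 : ℝ) ≤ m := by exact_mod_cast hm
  have hn : (2 * (m : ℝ) - 2) ≠ 0 := by linarith
  set s := Finset.range (2 * m - 1)
  set v : ℕ → ℝ := fun j => (j : ℝ) / (2 * (m : ℝ) - 2)
  have hinj : Set.InjOn v s := by
    intro i _ j _ hij
    have : (i : ℝ) = j := by simpa [v, div_left_inj' hn] using hij
    exact_mod_cast this
  have hint := Lagrange.eq_interpolate (s := s) (v := v) hinj (f := q) (by simpa [s] using hq)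
  have heval : ∀ u, q.eval u = ∑ j ∈ s, (∏ k ∈ s.erase j,
      ((2 * (m : ℝ) - 2) * u - (k : ℝ)) / ((j : ℝ) - (k : ℝ))) * q.eval (v j) := by
    intro u
    conv_lhs => rw [hint]
    simp only [Lagrange.interpolate_apply, Polynomial.eval_finsetSum, Polynomial.eval_mul,
      Polynomial.eval_C, Lagrange.basis, Polynomial.eval_prod]
    refine Finset.sum_congr rfl fun j _ => ?_
    rw [mul_comm]
    congr 1
    refine Finset.prod_congr rfl fun k hk => ?_
    have hkj : (j : ℝ) - k ≠ 0 :=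
      sub_ne_zero.2 (by exact_mod_cast (Finset.ne_of_mem_erase hk).symm)
    simp only [Lagrange.basisDivisor, Polynomial.eval_mul, Polynomial.eval_C, Polynomial.eval_sub,
      Polynomial.eval_X, v]
    rw [div_sub_div_same, inv_div, div_mul_eq_mul_div, mul_sub, mul_div_cancel₀ _ hn]
  have hm1 : m ≠ 1 := by omega
  rw [newtonCotes, if_neg hm1]
  rw [show (fun u => q.eval u) = _ from funext heval, intervalIntegral.integral_finsetSum]
  · refine Finset.sum_congr rfl fun j hj => ?_
    rw [intervalIntegral.integral_mul_const]
  · intro j _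
    apply Continuous.intervalIntegrable
    fun_prop

/-- Since the rule is exact on polynomials of degree at most `2m - 2`, its error is controlled by
the distance to such polynomials. -/
theorem exists_newtonCotes_error_bound {m : ℕ} (hm : 2 ≤ m) :
    ∃ C : ℝ, ∀ (φ : ℝ → ℝ) (q : Polynomial ℝ) (K : ℝ), Continuous φ →
      q.degree < ((2 * m - 1 : ℕ) : WithBot ℕ) →
      (∀ u ∈ Set.Icc (0 : ℝ) 1, |φ u - q.eval u| ≤ K) →
      |newtonCotes m φ - ∫ u in (0 : ℝ)..1, φ u| ≤ C * K := by
  have hm' : (2 : ℝ) ≤ m := by exact_mod_cast hm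
  set s := Finset.range (2 * m - 1) with hs
  set w : ℕ → ℝ := fun j => ∫ u in (0 : ℝ)..1, ∏ k ∈ s.erase j,
      ((2 * (m : ℝ) - 2) * u - (k : ℝ)) / ((j : ℝ) - (k : ℝ)) with hw
  refine ⟨∑ j ∈ s, |w j| + 1, fun φ q K hφ hq hK => ?_⟩
  have hm1 : m ≠ 1 := by omega
  have hnc : ∀ ψ, newtonCotes m ψ = ∑ j ∈ s, w j * ψ ((j : ℝ) / (2 * (m : ℝ) - 2)) := by
    intro ψ
    rw [newtonCotes, if_neg hm1]
  have h1 : |newtonCotes m φ - newtonCotes m (fun u => q.eval u)| ≤ (∑ j ∈ s, |w j|) * K := by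
    rw [hnc, hnc, ← Finset.sum_sub_distrib, Finset.sum_mul]
    refine (Finset.abs_sum_le_sum_abs _ _).trans (Finset.sum_le_sum fun j hj => ?_)
    rw [← mul_sub, abs_mul]
    refine mul_le_mul_of_nonneg_left (hK _ ⟨?_, ?_⟩) (abs_nonneg _)
    · apply div_nonneg (by positivity); linarith
    · rw [div_le_one (by linarith)]
      have : j + 2 ≤ 2 * m := by have := Finset.mem_range.1 hj; omega
      have : (j : ℝ) + 2 ≤ 2 * m := by exact_mod_cast this
      linarith
  have h2 : |(∫ u in (0 : ℝ)..1, q.eval u) - ∫ u in (0 : ℝ)..1, φ u| ≤ K := by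
    rw [← intervalIntegral.integral_sub (q.continuous.intervalIntegrable _ _)
      (hφ.intervalIntegrable _ _)]
    have := intervalIntegral.norm_integral_le_of_norm_le_const (a := (0 : ℝ)) (b := 1) (C := K)
      (f := fun u => q.eval u - φ u) (by
        intro u hu
        rw [Set.uIoc_of_le zero_le_one] at hu
        rw [Real.norm_eq_abs, abs_sub_comm]
        exact hK u ⟨hu.1.le, hu.2⟩)
    simpa using this
  rw [newtonCotes_eval_polynomial hm hq] at h1
  calc _ ≤ |newtonCotes m φ - ∫ u in (0 : ℝ)..1, q.eval u|
        + |(∫ u in (0 : ℝ)..1, q.eval u) - ∫ u in (0 : ℝ)..1, φ u| := abs_sub_le _ _ _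
    _ ≤ _ := by linarith

/-- Newton–Cotes approximation of the increment of a primitive `G` of `g`: the error is of order
`|h| ^ (2m)`, with a constant that depends on `g` only through its derivative of order `2m - 1` on
the segment from `b` to `b + h`. -/
theorem exists_newtonCotes_increment_bound {m : ℕ} (hm : 2 ≤ m) {g G : ℝ → ℝ}
    (hg : ContDiff ℝ (⊤ : ℕ∞) g) (hG : ∀ x, HasDerivAt G (g x) x) :
    ∃ C : ℝ, ∀ b h K : ℝ,
      (∀ u ∈ Set.Icc (0 : ℝ) 1, |iteratedDeriv (2 * m - 1) g (b + u * h)| ≤ K) →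
      |newtonCotes m (fun α => g (b + α * h)) * h - (G (b + h) - G b)| ≤
        C * K * |h| ^ (2 * m) := by
  obtain ⟨C, hC⟩ := exists_newtonCotes_error_bound hm
  obtain ⟨n, hn⟩ : ∃ n, 2 * m - 1 = n + 1 := ⟨2 * m - 2, by omega⟩
  have hn2 : 2 * m = n + 2 := by omega
  refine ⟨C, fun b h K hK => ?_⟩
  have hψ : ContDiff ℝ (⊤ : ℕ∞) fun α : ℝ => g (b + α * h) := hg.comp (by fun_prop)
  have hψ' : ∀ u ∈ Set.Icc (0 : ℝ) 1,
      iteratedDerivWithin (n + 1) (fun α => g (b + α * h)) (Set.Icc 0 1) u =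
        h ^ (n + 1) * iteratedDeriv (n + 1) g (b + u * h) := by
    intro u hu
    rw [iteratedDerivWithin_eq_iteratedDeriv (uniqueDiffOn_Icc zero_lt_one)
      (hψ.contDiffAt.of_le (by exact_mod_cast le_top)) hu]
    have hg' : ContDiff ℝ ((n + 1 : ℕ) : WithTop ℕ∞) fun z => g (b + z) :=
      (hg.comp (by fun_prop : ContDiff ℝ (⊤ : ℕ∞) fun z : ℝ => b + z)).of_le
        (by exact_mod_cast le_top)
    have h1 := iteratedDeriv_comp_const_mul hg' h
    have h2 := congrFun h1 u
    simp only [iteratedDeriv_comp_const_add] at h2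
    simpa only [mul_comm] using h2
  set q : Polynomial ℝ := ∑ k ∈ Finset.range (n + 1), Polynomial.C
    ((k.factorial : ℝ)⁻¹ * iteratedDerivWithin k (fun α => g (b + α * h)) (Set.Icc 0 1) 0) *
      Polynomial.X ^ k with hq
  have hdeg : q.degree < ((2 * m - 1 : ℕ) : WithBot ℕ) := by
    rw [hn, hq]
    refine (Polynomial.degree_sum_le _ _).trans_lt ?_
    rw [Finset.sup_lt_iff (WithBot.bot_lt_coe _)]
    intro k hk
    refine (Polynomial.degree_C_mul_X_pow_le _ _).trans_lt ?_
    exact_mod_cast Finset.mem_range.1 hk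
  have hK0 : 0 ≤ K := (abs_nonneg _).trans (hK 0 ⟨le_rfl, zero_le_one⟩)
  have hrem : ∀ u ∈ Set.Icc (0 : ℝ) 1, |g (b + u * h) - q.eval u| ≤ K * |h| ^ (n + 1) := by
    intro u hu
    have ht := taylor_mean_remainder_bound (n := n) (a := (0 : ℝ)) (b := 1) zero_le_one
      (C := K * |h| ^ (n + 1))
      ((hψ.of_le (by exact_mod_cast le_top)).contDiffOn) hu (by
        intro y hy
        rw [hψ' y hy, norm_mul, norm_pow, Real.norm_eq_abs, Real.norm_eq_abs, mul_comm]
        have := hK y hy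
        rw [hn] at this
        gcongr)
    rw [taylor_within_apply] at ht
    have hqe : q.eval u = ∑ k ∈ Finset.range (n + 1), ((k.factorial : ℝ)⁻¹ * (u - 0) ^ k) •
        iteratedDerivWithin k (fun α => g (b + α * h)) (Set.Icc 0 1) 0 := by
      simp only [hq, Polynomial.eval_finsetSum, Polynomial.eval_mul, Polynomial.eval_C,
        Polynomial.eval_pow, Polynomial.eval_X, smul_eq_mul, sub_zero]
      exact Finset.sum_congr rfl fun k _ => by ring
    rw [hqe, ← Real.norm_eq_abs]
    refine ht.trans ?_
    have hu1 : (u - 0) ^ (n + 1) ≤ 1 := pow_le_one₀ (by simpa using hu.1) (by simpa using hu.2)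
    have hfac : (1 : ℝ) ≤ n.factorial := by exact_mod_cast n.factorial_pos
    rw [div_le_iff₀ (by positivity)]
    have hKh : 0 ≤ K * |h| ^ (n + 1) := by positivity
    nlinarith [mul_le_mul_of_nonneg_left hu1 hKh, mul_le_mul_of_nonneg_left hfac hKh]
  have hmain := hC _ q _ hψ.continuous hdeg hrem
  have hftc : (∫ u in (0 : ℝ)..1, g (b + u * h)) * h = G (b + h) - G b := by
    rw [← intervalIntegral.integral_mul_const]
    have hd : ∀ u ∈ Set.uIcc (0 : ℝ) 1,
        HasDerivAt (fun u => G (b + u * h)) (g (b + u * h) * h) u := by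
      intro u _
      have h1 : HasDerivAt (fun u : ℝ => b + u * h) h u := by
        simpa using ((hasDerivAt_id u).mul_const h).const_add b
      exact (hG (b + u * h)).comp u h1
    rw [intervalIntegral.integral_eq_sub_of_hasDerivAt hd
      ((hψ.continuous.mul continuous_const).intervalIntegrable _ _)]
    simp
  rw [← hftc, ← sub_mul, abs_mul, hn2]
  calc _ ≤ C * (K * |h| ^ (n + 1)) * |h| := by gcongr
    _ = _ := by ring

/-! ### Fractional Brownian motion -/

/-- A process with almost surely continuous paths is indistinguishable from a process all of whose
paths are continuous and all of whose coordinates are measurable. -/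
theorem exists_continuous_measurable_modification {Ω : Type*} [MeasurableSpace Ω] {P : Measure Ω}
    {B : ℝ≥0 → Ω → ℝ} (hm : ∀ t, AEMeasurable (B t) P)
    (hc : ∀ᵐ ω ∂P, Continuous fun t => B t ω) :
    ∃ β : ℝ≥0 → Ω → ℝ, (∀ t, Measurable (β t)) ∧ (∀ ω, Continuous fun t => β t ω) ∧
      ∀ᵐ ω ∂P, ∀ t, B t ω = β t ω := by
  classical
  set D : ℕ → ℝ≥0 := TopologicalSpace.denseSeq ℝ≥0
  have hD : DenseRange D := TopologicalSpace.denseRange_denseSeq ℝ≥0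
  have hA : ∀ᵐ ω ∂P, (Continuous fun t => B t ω) ∧ ∀ n, B (D n) ω = (hm (D n)).mk _ ω :=
    hc.and (ae_all_iff.2 fun n => (hm (D n)).ae_eq_mk)
  set N := toMeasurable P {ω | ¬ ((Continuous fun t => B t ω) ∧
    ∀ n, B (D n) ω = (hm (D n)).mk _ ω)} with hN
  have hN0 : P N = 0 := by rw [hN, measure_toMeasurable]; exact hA
  have hNm : MeasurableSet N := measurableSet_toMeasurable _ _
  have hgood : ∀ ω ∉ N, (Continuous fun t => B t ω) ∧ ∀ n, B (D n) ω = (hm (D n)).mk _ ω := by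
    intro ω hω
    by_contra h
    exact hω (subset_toMeasurable _ _ h)
  refine ⟨fun t ω => if ω ∈ N then 0 else B t ω, fun t => ?_, fun ω => ?_, ?_⟩
  · obtain ⟨u, hu⟩ : ∃ u : ℕ → ℕ, Tendsto (fun k => D (u k)) atTop (𝓝 t) := by
      obtain ⟨x, hx, hxt⟩ := mem_closure_iff_seq_limit.1 (hD t)
      choose u hu using hx
      exact ⟨u, by simpa only [hu] using hxt⟩
    refine measurable_of_tendsto_metrizable
      (f := fun k ω => if ω ∈ N then 0 else (hm (D (u k))).mk _ ω)
      (fun k => Measurable.ite hNm measurable_const (hm _).measurable_mk) ?_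
    rw [tendsto_pi_nhds]
    intro ω
    by_cases hω : ω ∈ N
    · simp [hω]
    · simp only [hω, if_false]
      simp only [← (hgood ω hω).2]
      exact ((hgood ω hω).1.tendsto t).comp hu
  · by_cases hω : ω ∈ N
    · simp [hω, continuous_const]
    · simpa [hω] using (hgood ω hω).1
  · have : ∀ᵐ ω ∂P, ω ∉ N := measure_eq_zero_iff_ae_notMem.1 hN0
    filter_upwards [this] with ω hω t
    simp [hω]

/-- A centered Gaussian variable is a multiple of a standard one. -/
theorem gaussianReal_zero_eq_map_mul {v : ℝ≥0} {r : ℝ} (hr : r ^ 2 = v) :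
    gaussianReal 0 v = (gaussianReal 0 1).map (r * ·) := by
  rw [gaussianReal_map_const_mul, mul_zero]
  congr 1
  ext
  simp [hr]

section FBM

variable {Ω : Type*} [MeasurableSpace Ω] {P : Measure Ω} {H : ℝ} {B : ℝ≥0 → Ω → ℝ}

theorem IsFBM.integral_sq (hB : IsFBM P H B) (hH : 0 < H) (t : ℝ≥0) :
    ∫ ω, B t ω * B t ω ∂P = (t : ℝ) ^ (2 * H) := by
  rw [hB.covariance, sub_self, abs_zero, Real.zero_rpow (by positivity)]
  ring

theorem IsFBM.map_eq (hB : IsFBM P H B) (hH : 0 < H) (t : ℝ≥0) :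
    P.map (B t) = gaussianReal 0 (t ^ (2 * H)) := by
  have hg := hB.gaussian.hasGaussianLaw_eval t
  rw [hg.map_eq_gaussianReal, hB.centered t,
    variance_of_integral_eq_zero hg.aemeasurable (hB.centered t)]
  congr 1
  have : ∫ ω, (B t ω) ^ 2 ∂P = (t : ℝ) ^ (2 * H) := by
    simp_rw [sq]; exact hB.integral_sq hH t
  rw [this, ← NNReal.coe_rpow, Real.toNNReal_coe]

theorem IsFBM.map_increment_eq (hB : IsFBM P H B) (hH : 0 < H) (s t : ℝ≥0) :
    P.map (fun ω => B t ω - B s ω) = gaussianReal 0 (|(t : ℝ) - s| ^ (2 * H)).toNNReal := by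
  have hg := hB.gaussian.hasGaussianLaw_fun_sub (s := t) (t := s)
  have h2 : ∀ r, MemLp (B r) 2 P := fun r => (hB.gaussian.hasGaussianLaw_eval r).memLp_two
  have hint : ∀ r, Integrable (B r) P := fun r => (hB.gaussian.hasGaussianLaw_eval r).integrable
  have hc : ∫ ω, (B t ω - B s ω) ∂P = 0 := by
    rw [integral_sub (hint t) (hint s), hB.centered, hB.centered, sub_self]
  rw [hg.map_eq_gaussianReal, hc, variance_of_integral_eq_zero hg.aemeasurable hc]
  congr 2
  have h3 : ∀ r r', Integrable (fun ω => B r ω * B r' ω) P := fun r r' =>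
    (h2 r).integrable_mul (h2 r')
  calc ∫ ω, (B t ω - B s ω) ^ 2 ∂P
      = ∫ ω, (B t ω * B t ω - 2 * (B s ω * B t ω) + B s ω * B s ω) ∂P := by
        congr 1; funext ω; ring
    _ = |(t : ℝ) - s| ^ (2 * H) := by
        have h4 : Integrable (fun ω => B t ω * B t ω - 2 * (B s ω * B t ω)) P :=
          (h3 t t).sub ((h3 s t).const_mul 2)
        rw [integral_add h4 (h3 s s),
          integral_sub (h3 t t) ((h3 s t).const_mul 2), integral_const_mul,
          hB.integral_sq hH, hB.integral_sq hH, hB.covariance]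
        ring

/-- Scaling of the even moments of the increments. -/
theorem IsFBM.exists_lintegral_increment_pow (hB : IsFBM P H B) (hH : 0 < H) (m : ℕ) :
    ∃ M : ENNReal, M ≠ ⊤ ∧ ∀ s t : ℝ≥0,
      ∫⁻ ω, ENNReal.ofReal (|B t ω - B s ω| ^ (2 * m)) ∂P =
        ENNReal.ofReal (|(t : ℝ) - s| ^ (2 * H * m)) * M := by
  refine ⟨∫⁻ z, ENNReal.ofReal (|z| ^ (2 * m)) ∂(gaussianReal 0 1), ?_, fun s t => ?_⟩
  · have h := (memLp_id_gaussianReal' (μ := 0) (v := 1) ((2 * m : ℕ) : ENNReal)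
      (ENNReal.natCast_ne_top _)).integrable_norm_pow'
    have h2 := h.lintegral_lt_top
    simpa using h2.ne
  · have hm : AEMeasurable (fun ω => B t ω - B s ω) P :=
      (hB.gaussian.hasGaussianLaw_fun_sub (s := t) (t := s)).aemeasurable
    set r : ℝ := |(t : ℝ) - s| ^ H with hr
    have hr0 : 0 ≤ r := by positivity
    have hr2 : r ^ 2 = |(t : ℝ) - s| ^ (2 * H) := by
      rw [hr, ← Real.rpow_natCast, ← Real.rpow_mul (abs_nonneg _)]; congr 1; push_cast; ring
    have hrm : r ^ (2 * m) = |(t : ℝ) - s| ^ (2 * H * m) := by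
      rw [hr, ← Real.rpow_natCast, ← Real.rpow_mul (abs_nonneg _)]; congr 1; push_cast; ring
    have h1 : ∫⁻ ω, ENNReal.ofReal (|B t ω - B s ω| ^ (2 * m)) ∂P =
        ∫⁻ z, ENNReal.ofReal (|z| ^ (2 * m)) ∂(P.map fun ω => B t ω - B s ω) :=
      (lintegral_map' (f := fun z : ℝ => ENNReal.ofReal (|z| ^ (2 * m))) (by fun_prop) hm).symm
    rw [h1, hB.map_increment_eq hH, gaussianReal_zero_eq_map_mul (r := r)
      (by rw [hr2, Real.coe_toNNReal _ (by positivity)]),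
      lintegral_map (by fun_prop) (by fun_prop), ← lintegral_const_mul _ (by fun_prop)]
    refine lintegral_congr fun z => ?_
    rw [abs_mul, mul_pow, abs_of_nonneg hr0, hrm, ENNReal.ofReal_mul (by positivity)]

end FBM

/-! ### The Newton–Cotes integral of a function of the fractional Brownian motion -/

/-- Pathwise change of variables: if the power variation of order `2m` at scale `ε n`
of a continuous path vanishes in the limit, then the `ε n`-approximations of the Newton–Cotes
integral of `g` along the path converge to the increment of a primitive of `g`. -/
theorem tendsto_newtonCotes_of_variation_tendsto_zero {m : ℕ} (hm : 2 ≤ m) {g G : ℝ → ℝ}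
    (hg : ContDiff ℝ (⊤ : ℕ∞) g) (hG : ∀ x, HasDerivAt G (g x) x)
    {b : ℝ → ℝ} (hb : Continuous b) {t : ℝ} (ht : 0 ≤ t) {ε : ℕ → ℝ} (hε0 : ∀ n, 0 < ε n)
    (hε1 : ∀ n, ε n ≤ 1) (hε : Tendsto ε atTop (𝓝 0))
    (hV : Tendsto (fun n => (ε n)⁻¹ * ∫ s in (0 : ℝ)..t, |b (s + ε n) - b s| ^ (2 * m))
      atTop (𝓝 0)) :
    Tendsto (fun n => (ε n)⁻¹ * ∫ s in (0 : ℝ)..t,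
      newtonCotes m (fun α => g (b s + α * (b (s + ε n) - b s))) * (b (s + ε n) - b s))
      atTop (𝓝 (G (b t) - G (b 0))) := by
  obtain ⟨C, hC⟩ := exists_newtonCotes_increment_bound hm hg hG
  have hGc : Continuous G := continuous_iff_continuousAt.2 fun x => (hG x).continuousAt
  have hgc : Continuous g := hg.continuous
  -- a bound of the derivative of `g` on the convex hull of the relevant part of the path
  obtain ⟨R, hR⟩ : ∃ R, ∀ s ∈ Set.Icc (0 : ℝ) (t + 1), |b s| ≤ R :=
    isCompact_Icc.exists_bound_of_continuousOn (f := b) hb.continuousOn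
  obtain ⟨K, hK⟩ : ∃ K, ∀ x ∈ Set.Icc (-R) R, |iteratedDeriv (2 * m - 1) g x| ≤ K :=
    isCompact_Icc.exists_bound_of_continuousOn
      (hg.continuous_iteratedDeriv _ (WithTop.coe_le_coe.2 le_top)).continuousOn
  have hK' : ∀ n, ∀ s ∈ Set.Icc (0 : ℝ) t, ∀ u ∈ Set.Icc (0 : ℝ) 1,
      |iteratedDeriv (2 * m - 1) g (b s + u * (b (s + ε n) - b s))| ≤ K := by
    intro n s hs u hu
    apply hK
    have h1 := abs_le.1 (hR s ⟨hs.1, by linarith [hs.2]⟩)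
    have h2 := abs_le.1 (hR (s + ε n) ⟨by linarith [hs.1, hε0 n], by linarith [hs.2, hε1 n]⟩)
    constructor <;> nlinarith [hu.1, hu.2]
  have hNC : ∀ n, Continuous fun s =>
      newtonCotes m (fun α => g (b s + α * (b (s + ε n) - b s))) * (b (s + ε n) - b s) := by
    intro n
    have hm1 : m ≠ 1 := by omega
    simp only [newtonCotes, if_neg hm1]
    fun_prop
  have hGi : ∀ n, Continuous fun s => G (b (s + ε n)) - G (b s) := fun n => by fun_prop
  have herr : ∀ n, |(ε n)⁻¹ * (∫ s in (0 : ℝ)..t,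
      newtonCotes m (fun α => g (b s + α * (b (s + ε n) - b s))) * (b (s + ε n) - b s)) -
      (ε n)⁻¹ * ∫ s in (0 : ℝ)..t, (G (b (s + ε n)) - G (b s))| ≤
      C * K * ((ε n)⁻¹ * ∫ s in (0 : ℝ)..t, |b (s + ε n) - b s| ^ (2 * m)) := by
    intro n
    rw [← mul_sub, abs_mul, abs_of_pos (inv_pos.2 (hε0 n)), mul_left_comm (C * K),
      ← intervalIntegral.integral_sub ((hNC n).intervalIntegrable _ _)
        ((hGi n).intervalIntegrable _ _), ← intervalIntegral.integral_const_mul]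
    refine mul_le_mul_of_nonneg_left ?_ (inv_pos.2 (hε0 n)).le
    refine (intervalIntegral.abs_integral_le_integral_abs ht).trans ?_
    refine intervalIntegral.integral_mono_on ht ?_ ?_ fun s hs => ?_
    · exact ((hNC n).sub (hGi n)).abs.intervalIntegrable _ _
    · apply Continuous.intervalIntegrable
      fun_prop
    · have := hC (b s) (b (s + ε n) - b s) K (hK' n s hs)
      rwa [add_sub_cancel] at this
  have hmain : Tendsto (fun n => (ε n)⁻¹ * ∫ s in (0 : ℝ)..t, (G (b (s + ε n)) - G (b s)))
      atTop (𝓝 (G (b t) - G (b 0))) := by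
    set F : ℝ → ℝ := fun x => ∫ s in (0 : ℝ)..x, G (b s) with hF
    have hGb : Continuous fun s => G (b s) := hGc.comp hb
    have hFd : ∀ x, HasDerivAt F (G (b x)) x := fun x =>
      intervalIntegral.integral_hasDerivAt_right (hGb.intervalIntegrable _ _)
        (hGb.stronglyMeasurableAtFilter _ _) hGb.continuousAt
    have hε' : Tendsto ε atTop (𝓝[>] 0) :=
      tendsto_nhdsWithin_iff.2 ⟨hε, Eventually.of_forall hε0⟩
    have h1 := ((hFd t).tendsto_slope_zero_right.comp hε').sub
      ((hFd 0).tendsto_slope_zero_right.comp hε')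
    refine h1.congr fun n => ?_
    have h2 : (∫ s in (0 : ℝ)..t, G (b (s + ε n))) = F (t + ε n) - F (0 + ε n) := by
      rw [intervalIntegral.integral_comp_add_right (fun s => G (b s)),
        intervalIntegral.integral_interval_sub_left] <;>
      exact hGb.intervalIntegrable _ _
    have h3 : Continuous fun s => G (b (s + ε n)) := by fun_prop
    rw [intervalIntegral.integral_sub (h3.intervalIntegrable _ _) (hGb.intervalIntegrable _ _), h2]
    have h4 : F 0 = 0 := by simp [hF]
    simp only [Function.comp_apply, smul_eq_mul, h4]
    ring
  have hdiff := squeeze_zero_norm (fun n => (Real.norm_eq_abs _).trans_le (herr n))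
    (by simpa using hV.const_mul (C * K))
  simpa using hmain.add hdiff

section FBM

variable {Ω : Type*} [MeasurableSpace Ω] {P : Measure Ω} [IsProbabilityMeasure P] {H : ℝ}
  {B : ℝ≥0 → Ω → ℝ}

/-- The rescaled power variation of order `2m` of the fractional Brownian motion vanishes almost
surely along `ε = 1 / (n + 1)` when `2 H m ≥ 3`: its expectation is `O(n⁻²)`, hence summable. -/
theorem IsFBM.ae_tendsto_variation_zero (hB : IsFBM P H B) (hH : 0 < H) {m : ℕ}
    (hm : 3 ≤ 2 * H * m) {β : ℝ≥0 → Ω → ℝ} (hβm : ∀ t, Measurable (β t))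
    (hβc : ∀ ω, Continuous fun t => β t ω) (hβ : ∀ᵐ ω ∂P, ∀ t, B t ω = β t ω) {t : ℝ}
    (ht : 0 ≤ t) :
    ∀ᵐ ω ∂P, Tendsto (fun n : ℕ => (1 / ((n : ℝ) + 1))⁻¹ * ∫ s in (0 : ℝ)..t,
      |β (s + 1 / ((n : ℝ) + 1)).toNNReal ω - β s.toNNReal ω| ^ (2 * m)) atTop (𝓝 0) := by
  obtain ⟨M, hM, hMB⟩ := hB.exists_lintegral_increment_pow hH m
  set ε : ℕ → ℝ := fun n => 1 / ((n : ℝ) + 1) with hε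
  have hε0 : ∀ n, 0 < ε n := fun n => Nat.one_div_pos_of_nat
  have hε1 : ∀ n, ε n ≤ 1 := fun n => by
    rw [hε, div_le_one (by positivity)]; linarith [n.cast_nonneg (α := ℝ)]
  set φ : ℕ → Ω → ℝ → ℝ := fun n ω s =>
    (ε n)⁻¹ * |β (s + ε n).toNNReal ω - β s.toNNReal ω| ^ (2 * m) with hφ
  have hunc : Measurable (Function.uncurry fun (s : ℝ≥0) ω => β s ω) :=
    measurable_uncurry_of_continuous_of_measurable hβc hβm
  have hmeas : ∀ n, Measurable (fun z : Ω × ℝ => φ n z.1 z.2) := by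
    intro n
    have h1 : Measurable fun z : Ω × ℝ => β z.2.toNNReal z.1 :=
      hunc.comp (by fun_prop : Measurable fun z : Ω × ℝ => (z.2.toNNReal, z.1))
    have h2 : Measurable fun z : Ω × ℝ => β (z.2 + ε n).toNNReal z.1 :=
      hunc.comp (by fun_prop : Measurable fun z : Ω × ℝ => ((z.2 + ε n).toNNReal, z.1))
    simp only [hφ]
    exact (((h2.sub h1).abs).pow_const _).const_mul _
  have hφc : ∀ n ω, Continuous (φ n ω) := by
    intro n ω
    have h1 : Continuous fun s : ℝ => β s.toNNReal ω := (hβc ω).comp continuous_real_toNNReal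
    have h2 : Continuous fun s : ℝ => β (s + ε n).toNNReal ω := h1.comp (by fun_prop)
    simp only [hφ]
    fun_prop
  have hφ0 : ∀ n ω s, 0 ≤ φ n ω s := fun n ω s => by
    have := hε0 n
    simp only [hφ]; positivity
  set V : ℕ → Ω → ENNReal := fun n ω => ∫⁻ s in Set.Ioc 0 t, ENNReal.ofReal (φ n ω s) with hV
  have hVm : ∀ n, Measurable (V n) := fun n => by
    exact (hmeas n).ennreal_ofReal.lintegral_prod_right'
  have hVE : ∀ n, ∫⁻ ω, V n ω ∂P ≤
      ENNReal.ofReal (1 / ((n : ℝ) + 1) ^ 2) * (M * ENNReal.ofReal t) := by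
    intro n
    rw [hV]
    dsimp only
    rw [lintegral_lintegral_swap (hmeas n).ennreal_ofReal.aemeasurable]
    have hin : ∀ s ∈ Set.Ioc 0 t, ∫⁻ ω, ENNReal.ofReal (φ n ω s) ∂P ≤
        ENNReal.ofReal (1 / ((n : ℝ) + 1) ^ 2) * M := by
      intro s hs
      have hs0 : 0 ≤ s + ε n := by linarith [hs.1, hε0 n]
      have h1 : ∫⁻ ω, ENNReal.ofReal (φ n ω s) ∂P = ENNReal.ofReal (ε n)⁻¹ *
          ∫⁻ ω, ENNReal.ofReal (|B (s + ε n).toNNReal ω - B s.toNNReal ω| ^ (2 * m)) ∂P := by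
        rw [← lintegral_const_mul' _ _ ENNReal.ofReal_ne_top]
        refine lintegral_congr_ae ?_
        filter_upwards [hβ] with ω hω
        rw [← ENNReal.ofReal_mul (inv_pos.2 (hε0 n)).le, hω, hω]
      rw [h1, hMB, ← mul_assoc, ← ENNReal.ofReal_mul (inv_pos.2 (hε0 n)).le,
        Real.coe_toNNReal _ hs0, Real.coe_toNNReal _ hs.1.le, add_sub_cancel_left,
        abs_of_pos (hε0 n)]
      gcongr
      calc (ε n)⁻¹ * ε n ^ (2 * H * m) ≤ (ε n)⁻¹ * ε n ^ (3 : ℝ) := by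
            refine mul_le_mul_of_nonneg_left ?_ (inv_pos.2 (hε0 n)).le
            exact Real.rpow_le_rpow_of_exponent_ge (hε0 n) (hε1 n) hm
        _ = (ε n) ^ 2 := by
            have := (hε0 n).ne'
            rw [show (3 : ℝ) = ((3 : ℕ) : ℝ) by norm_num, Real.rpow_natCast]
            field_simp
        _ = _ := by rw [hε]; simp
    calc _ ≤ ∫⁻ s in Set.Ioc 0 t, ENNReal.ofReal (1 / ((n : ℝ) + 1) ^ 2) * M :=
          setLIntegral_mono measurable_const hin
      _ = _ := by
          rw [setLIntegral_const, Real.volume_Ioc, sub_zero, mul_assoc]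
  have hsum : Summable fun n : ℕ => 1 / ((n : ℝ) + 1) ^ 2 := by
    have := (summable_nat_add_iff (f := fun n : ℕ => 1 / (n : ℝ) ^ 2) 1).2
      (Real.summable_one_div_nat_pow.2 one_lt_two)
    simpa using this
  have hfin : ∫⁻ ω, ∑' n, V n ω ∂P ≠ ⊤ := by
    rw [lintegral_tsum fun n => (hVm n).aemeasurable]
    refine ne_top_of_le_ne_top ?_ (ENNReal.tsum_le_tsum hVE)
    rw [ENNReal.tsum_mul_right]
    exact ENNReal.mul_ne_top hsum.tsum_ofReal_ne_top (ENNReal.mul_ne_top hM ENNReal.ofReal_ne_top)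
  filter_upwards [ae_lt_top' (AEMeasurable.tsum fun n => (hVm n).aemeasurable) hfin]
    with ω hω
  have h0 := (ENNReal.tendsto_toReal ENNReal.zero_ne_top).comp
    (ENNReal.tendsto_atTop_zero_of_tsum_ne_top hω.ne)
  refine h0.congr fun n => ?_
  rw [← intervalIntegral.integral_const_mul, intervalIntegral.integral_of_le ht,
    integral_eq_lintegral_of_nonneg_ae (ae_of_all _ (hφ0 n ω))
      (hφc n ω).aestronglyMeasurable]
  rfl

/-- **Fundamental theorem for the Newton–Cotes functional** of sufficiently high order: the
integral of `g(B)` against the fractional Brownian motion `B` is the increment of `G(B)`, for a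
primitive `G` of `g`. -/
theorem IsNewtonCotesIntegral.ae_eq_sub (hB : IsFBM P H B) (hH : 0 < H) {m : ℕ} (hm2 : 2 ≤ m)
    (hm : 3 ≤ 2 * H * m) {g G : ℝ → ℝ} (hg : ContDiff ℝ (⊤ : ℕ∞) g)
    (hG : ∀ x, HasDerivAt G (g x) x) {t : ℝ≥0} {I : Ω → ℝ}
    (hI : IsNewtonCotesIntegral P m g B t I) :
    ∀ᵐ ω ∂P, I ω = G (B t ω) - G (B 0 ω) := by
  obtain ⟨β, hβm, hβc, hβ⟩ :=
    exists_continuous_measurable_modification hB.gaussian.aemeasurable hB.continuous_paths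
  have hε0 : ∀ n : ℕ, (0 : ℝ) < 1 / ((n : ℝ) + 1) := fun n => Nat.one_div_pos_of_nat
  have hε1 : ∀ n : ℕ, 1 / ((n : ℝ) + 1) ≤ 1 := fun n => by
    rw [div_le_one (by positivity)]; linarith [n.cast_nonneg (α := ℝ)]
  have hε : Tendsto (fun n : ℕ => 1 / ((n : ℝ) + 1)) atTop (𝓝 0) :=
    tendsto_one_div_add_atTop_nhds_zero_nat
  have hε' : Tendsto (fun n : ℕ => 1 / ((n : ℝ) + 1)) atTop (𝓝[>] 0) :=
    tendsto_nhdsWithin_iff.2 ⟨hε, Eventually.of_forall hε0⟩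
  obtain ⟨ns, hns, hlim⟩ := (hI.comp hε').exists_seq_tendsto_ae
  filter_upwards [hβ, hlim, hB.ae_tendsto_variation_zero hH hm hβm hβc hβ t.coe_nonneg]
    with ω hω h1 h2
  have h3 := (tendsto_newtonCotes_of_variation_tendsto_zero hm2 hg hG
    (b := fun s => β s.toNNReal ω) ((hβc ω).comp continuous_real_toNNReal) t.coe_nonneg hε0 hε1 hε
    h2).comp hns.tendsto_atTop
  simp only [Function.comp_apply, hω] at h1 ⊢
  simpa using tendsto_nhds_unique h1 h3

omit [IsProbabilityMeasure P] in
theorem IsFBM.ae_eq_zero (hB : IsFBM P H B) (hH : 0 < H) : ∀ᵐ ω ∂P, B 0 ω = 0 := by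
  have h := hB.map_eq hH 0
  rw [NNReal.zero_rpow (by positivity), gaussianReal_zero_var] at h
  have h2 : ∀ᵐ x ∂(P.map (B 0)), x = 0 := by rw [h, ae_dirac_eq]; rfl
  exact ae_of_ae_map (hB.gaussian.aemeasurable 0) h2

/-- A pathwise solution is `f(B_t)` for a solution `f` of the ordinary differential equation
`f' = σ(f)`, `f(0) = x₀`. -/
theorem IsPathwiseSolution.exists_flow (hB : IsFBM P H B) (hH : 0 < H) {σ : ℝ → ℝ}
    (hσ : ContDiff ℝ (⊤ : ℕ∞) σ) {x₀ : ℝ} {X : ℝ≥0 → Ω → ℝ}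
    (hX : IsPathwiseSolution P H B σ x₀ X) :
    ∃ f : ℝ → ℝ, f 0 = x₀ ∧ (∀ y, HasDerivAt f (σ (f y)) y) ∧
      ∀ t, ∀ᵐ ω ∂P, X t ω = f (B t ω) := by
  obtain ⟨f, hf, hXf, hNC⟩ := hX
  have hg : ContDiff ℝ (⊤ : ℕ∞) fun x => σ (f x) := hσ.comp hf
  set G : ℝ → ℝ := fun x => ∫ y in (0 : ℝ)..x, σ (f y) with hGdef
  have hG : ∀ x, HasDerivAt G (σ (f x)) x := fun x =>
    intervalIntegral.integral_hasDerivAt_right (hg.continuous.intervalIntegrable _ _)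
      (hg.continuous.stronglyMeasurableAtFilter _ _) hg.continuous.continuousAt
  have hGc : Continuous G := continuous_iff_continuousAt.2 fun x => (hG x).continuousAt
  have hG0 : G 0 = 0 := by simp [hGdef]
  -- every order `m` with `H > 1 / (4m + 2)` is admissible; a large one makes the remainder small
  obtain ⟨m, hm⟩ : ∃ m : ℕ, 2 + 3 / (2 * H) ≤ m := exists_nat_ge _
  have hq : 0 < 3 / (2 * H) := by positivity
  have hm2 : 2 ≤ m := by
    have : (2 : ℝ) ≤ m := by linarith
    exact_mod_cast this
  have hm3 : 3 ≤ 2 * H * m := by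
    have : 3 / (2 * H) ≤ m := by linarith
    rw [div_le_iff₀ (by positivity)] at this
    linarith
  have hadm : 1 / (4 * (m : ℝ) + 2) < H := by
    rw [div_lt_iff₀ (by positivity)]
    nlinarith
  have hsol : ∀ t, ∀ᵐ ω ∂P, f (B t ω) = x₀ + G (B t ω) := by
    intro t
    filter_upwards [IsNewtonCotesIntegral.ae_eq_sub hB hH hm2 hm3 hg hG
      (hNC m (by omega) hadm t), hXf t, hB.ae_eq_zero hH] with ω h1 h2 h3
    rw [h3, hG0, h2] at h1
    linarith
  -- the law of `B 1` has full support
  have hfG : f = fun x => x₀ + G x := by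
    have h1 : ∀ᵐ x ∂(gaussianReal 0 1), f x = x₀ + G x := by
      have h2 := hB.map_eq hH 1
      rw [NNReal.one_rpow] at h2
      rw [← h2]
      exact (ae_map_iff (hB.gaussian.aemeasurable 1)
        (measurableSet_eq_fun hf.continuous.measurable
          (hGc.measurable.const_add _))).2 (hsol 1)
    have h3 : ∀ᵐ x, f x = x₀ + G x :=
      (gaussianReal_absolutelyContinuous' 0 one_ne_zero).ae_le h1
    exact (hf.continuous.ae_eq_iff_eq volume (by fun_prop)).1 h3
  refine ⟨f, ?_, fun y => ?_, hXf⟩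
  · rw [hfG]; simp [hG0]
  · have h := (hG y).const_add x₀
    rw [← hfG] at h
    exact h

end FBM

/-! ### Extension by zero along an open embedding -/

theorem Topology.IsOpenEmbedding.continuous_extend_zero {α β : Type*} [TopologicalSpace α]
    [TopologicalSpace β] [T2Space β] {f : α → β} (hf : IsOpenEmbedding f) {ρ : α → ℝ}
    (hρ : Continuous ρ) (h0 : Tendsto ρ (cocompact α) (𝓝 0)) :
    Continuous (Function.extend f ρ 0) := by
  rw [continuous_iff_continuousAt]
  intro x
  by_cases hx : ∃ y, f y = x
  · obtain ⟨y, rfl⟩ := hx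
    rw [← hf.continuousAt_iff, Function.extend_comp hf.injective]
    exact hρ.continuousAt
  · rw [ContinuousAt, Function.extend_apply' _ _ _ hx, Metric.tendsto_nhds]
    intro δ hδ
    have h1 : ∀ᶠ y in cocompact α, dist (ρ y) 0 < δ := Metric.tendsto_nhds.1 h0 δ hδ
    obtain ⟨K, hK, hKs⟩ := mem_cocompact.1 h1
    have hxK : x ∈ (f '' K)ᶜ := fun ⟨y, _, hy⟩ => hx ⟨y, hy⟩
    filter_upwards [(hK.image hf.continuous).isClosed.isOpen_compl.mem_nhds hxK] with z hz
    by_cases hz' : ∃ y, f y = z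
    · obtain ⟨y, rfl⟩ := hz'
      rw [hf.injective.extend_apply]
      exact hKs fun hy => hz ⟨y, hy, rfl⟩
    · rw [Function.extend_apply' _ _ _ hz']
      simpa using hδ

theorem isOpenEmbedding_of_hasStrictDerivAt {f f' : ℝ → ℝ}
    (hf : ∀ y, HasStrictDerivAt f (f' y) y) (h0 : ∀ y, f' y ≠ 0) : IsOpenEmbedding f := by
  have hc : Continuous f := continuous_iff_continuousAt.2 fun y => (hf y).hasDerivAt.continuousAt
  refine .of_continuous_injective_isOpenMap hc ?_ (isOpenMap_of_hasStrictDerivAt hf h0)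
  -- Rolle's theorem
  have key : ∀ a b, a < b → f a ≠ f b := fun a b hab heq => by
    obtain ⟨c, _, hc'⟩ := exists_hasDerivAt_eq_zero hab hc.continuousOn heq
      fun x _ => (hf x).hasDerivAt
    exact h0 c hc'
  intro a b hab
  by_contra hne
  rcases lt_or_gt_of_ne hne with h | h
  · exact key a b h hab
  · exact key b a h hab.symm

/-- The extension of `ρ` along `f` is `ρ ∘ f⁻¹` on the open range of `f`, hence has derivative
`ρ' / f'`, written `d` here. -/
theorem hasDerivAt_extend {f ρ : ℝ → ℝ} {g : ℝ → ℝ} {d f' ρ' y : ℝ} (hf : IsOpenEmbedding f)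
    (hf' : HasDerivAt f f' y) (h0 : f' ≠ 0) (hρ : HasDerivAt ρ ρ' y) (hd : ρ' = d * f') :
    HasDerivAt (Function.extend f ρ g) d (f y) := by
  set e := hf.toOpenPartialHomeomorph f with he
  have hey : e y = f y := rfl
  have hsymm : e.symm (f y) = y := by
    rw [← hey]; exact e.left_inv (by simp [he])
  have htarget : f y ∈ e.target := by simp [he]
  have h1 : HasDerivAt e.symm f'⁻¹ (f y) := by
    refine e.hasDerivAt_symm htarget h0 ?_
    rw [hsymm]
    exact hf'
  have h2 : HasDerivAt (fun x => ρ (e.symm x)) (ρ' * f'⁻¹) (f y) :=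
    HasDerivAt.comp (f y) (by rwa [hsymm]) h1
  have hd' : ρ' * f'⁻¹ = d := by rw [hd, mul_assoc, mul_inv_cancel₀ h0, mul_one]
  rw [hd'] at h2
  refine h2.congr_of_eventuallyEq ?_
  filter_upwards [e.open_target.mem_nhds htarget] with x hx
  have hfx : f (e.symm x) = x := e.right_inv hx
  conv_lhs => rw [← hfx]
  rw [hf.injective.extend_apply]

/-- Change of variables along an open embedding `f` of the line: a density `|f'| ρ` is transported
to the extension by zero of `ρ`. -/
theorem map_withDensity_eq_withDensity_extend {f f' ρ : ℝ → ℝ} (hf : IsOpenEmbedding f)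
    (hf' : ∀ y, HasDerivAt f (f' y) y) :
    (volume.withDensity fun y => ENNReal.ofReal (|f' y| * ρ y)).map f =
      volume.withDensity fun x => ENNReal.ofReal (Function.extend f ρ 0 x) := by
  ext A hA
  have hfm : Measurable f := hf.continuous.measurable
  rw [Measure.map_apply hfm hA, withDensity_apply _ (hfm hA), withDensity_apply _ hA]
  have h1 := lintegral_image_eq_lintegral_abs_deriv_mul (hfm hA)
    (fun y _ => (hf' y).hasDerivWithinAt) hf.injective.injOn
    (fun x => ENNReal.ofReal (Function.extend f ρ 0 x))
  have h2 : ∀ y, ENNReal.ofReal |f' y| * ENNReal.ofReal (Function.extend f ρ 0 (f y)) =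
      ENNReal.ofReal (|f' y| * ρ y) := fun y => by
    rw [hf.injective.extend_apply, ENNReal.ofReal_mul (abs_nonneg _)]
  simp only [h2] at h1
  rw [← h1, Set.image_preimage_eq_inter_range]
  have hr : MeasurableSet (Set.range f) := hf.isOpen_range.measurableSet
  rw [Set.inter_comm, ← Measure.restrict_restrict hr, ← lintegral_indicator hr]
  refine lintegral_congr fun x => ?_
  by_cases hx : x ∈ Set.range f
  · simp [hx]
  · rw [Set.indicator_of_notMem hx, Function.extend_apply' _ _ _ hx]
    simp

theorem integrable_iff_integrable_comp_of_eq_zero {f f' F : ℝ → ℝ} (hf : IsOpenEmbedding f)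
    (hf' : ∀ y, HasDerivAt f (f' y) y) (hF : ∀ x ∉ Set.range f, F x = 0) :
    Integrable F ↔ Integrable fun y => |f' y| * F (f y) := by
  have h := integrableOn_image_iff_integrableOn_abs_deriv_smul MeasurableSet.univ
    (fun y _ => (hf' y).hasDerivWithinAt) hf.injective.injOn F
  rw [Set.image_univ, integrableOn_univ, integrableOn_iff_integrable_of_support_subset] at h
  · exact h
  · intro x hx
    by_contra h'
    exact hx (hF x h')

theorem integral_eq_integral_comp_of_eq_zero {f f' F : ℝ → ℝ} (hf : IsOpenEmbedding f)
    (hf' : ∀ y, HasDerivAt f (f' y) y) (hF : ∀ x ∉ Set.range f, F x = 0) :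
    ∫ x, F x = ∫ y, |f' y| * F (f y) := by
  have h := integral_image_eq_integral_abs_deriv_smul MeasurableSet.univ
    (fun y _ => (hf' y).hasDerivWithinAt) hf.injective.injOn F
  rw [Set.image_univ, setIntegral_univ, setIntegral_eq_integral_of_forall_compl_eq_zero hF] at h
  exact h

/-! ### Autonomous scalar differential equations -/

theorem abs_le_add_mul_abs_of_hasDerivAt {L ℓ : ℝ → ℝ} {C : ℝ} (hL : ∀ y, HasDerivAt L (ℓ y) y)
    (hC : ∀ y, |ℓ y| ≤ C) (y : ℝ) : |L y| ≤ |L 0| + C * |y| := by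
  have h1 := Convex.norm_image_sub_le_of_norm_hasDerivWithin_le (s := Set.univ)
    (f := L) (f' := ℓ) (C := C) (x := 0) (y := y)
    (fun z _ => (hL z).hasDerivWithinAt) (fun z _ => hC z) convex_univ trivial trivial
  rw [Real.norm_eq_abs, Real.norm_eq_abs, sub_zero] at h1
  have h2 := abs_sub_abs_le_abs_sub (L y) (L 0)
  linarith

section Flow

variable {σ f : ℝ → ℝ}

/-- A solution of `f' = σ(f)` that does not start at a zero of `σ` never reaches one, because
`σ(f)` solves the linear equation `g' = σ'(f) g`. -/
theorem speed_ne_zero (hσ : ContDiff ℝ (⊤ : ℕ∞) σ) (hf : ∀ y, HasDerivAt f (σ (f y)) y)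
    (h0 : σ (f 0) ≠ 0) (y : ℝ) : σ (f y) ≠ 0 := by
  have hfc : Continuous f := continuous_iff_continuousAt.2 fun y => (hf y).continuousAt
  have hσd : ∀ x, HasDerivAt σ (deriv σ x) x := fun x =>
    (hσ.differentiable (by simp) x).hasDerivAt
  have hℓ : Continuous fun y => deriv σ (f y) := (hσ.continuous_deriv (by simp)).comp hfc
  set Λ : ℝ → ℝ := fun y => ∫ u in (0 : ℝ)..y, deriv σ (f u) with hΛ
  have hΛd : ∀ y, HasDerivAt Λ (deriv σ (f y)) y := fun y =>
    intervalIntegral.integral_hasDerivAt_right (hℓ.intervalIntegrable _ _)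
      (hℓ.stronglyMeasurableAtFilter _ _) hℓ.continuousAt
  have hg : ∀ y, HasDerivAt (fun y => σ (f y)) (deriv σ (f y) * σ (f y)) y := fun y =>
    (hσd (f y)).comp y (hf y)
  have hk : ∀ y, HasDerivAt (fun y => σ (f y) * Real.exp (-Λ y)) 0 y := fun y => by
    have h1 := (hg y).mul ((hΛd y).neg.exp)
    have h2 : deriv σ (f y) * σ (f y) * Real.exp (-Λ y) +
        σ (f y) * (Real.exp (-Λ y) * -deriv σ (f y)) = 0 := by ring
    exact h2 ▸ h1
  have hconst := is_const_of_deriv_eq_zero (fun y => (hk y).differentiableAt)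
    (fun y => (hk y).deriv) y 0
  intro hy
  simp only [hy, zero_mul] at hconst
  exact mul_ne_zero h0 (Real.exp_ne_zero _) hconst.symm

/-- The logarithm of the speed `|σ(f)|` of the solution (`Real.log x` is `log |x|`). -/
noncomputable def logSpeed (σ f : ℝ → ℝ) (y : ℝ) : ℝ := Real.log (σ (f y))

theorem exp_logSpeed {y : ℝ} (h : σ (f y) ≠ 0) : Real.exp (logSpeed σ f y) = |σ (f y)| :=
  Real.exp_log_eq_abs h

theorem hasDerivAt_logSpeed (hσ : ContDiff ℝ (⊤ : ℕ∞) σ) (hf : ∀ y, HasDerivAt f (σ (f y)) y)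
    {y : ℝ} (h : σ (f y) ≠ 0) : HasDerivAt (logSpeed σ f) (deriv σ (f y)) y := by
  have h1 : HasDerivAt (fun y => σ (f y)) (deriv σ (f y) * σ (f y)) y :=
    (hσ.differentiable (by simp) (f y)).hasDerivAt.comp y (hf y)
  have h2 := h1.log h
  rwa [mul_div_cancel_right₀ _ h] at h2

/-- If `σ'` is bounded by `C`, then the logarithm of the speed has linear growth. -/
theorem abs_logSpeed_le (hσ : ContDiff ℝ (⊤ : ℕ∞) σ) (hf : ∀ y, HasDerivAt f (σ (f y)) y)
    (h : ∀ y, σ (f y) ≠ 0) {C : ℝ} (hC : ∀ x, |deriv σ x| ≤ C) (y : ℝ) :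
    |logSpeed σ f y| ≤ |logSpeed σ f 0| + C * |y| :=
  abs_le_add_mul_abs_of_hasDerivAt (fun z => hasDerivAt_logSpeed hσ hf (h z)) (fun _ => hC _) y

end Flow

/-! ### Gaussian integrals of functions of exponential growth -/

theorem integrable_gaussianReal_of_abs_le_exp {v : ℝ≥0} {F : ℝ → ℝ} (hF : Continuous F)
    {A c : ℝ} (h : ∀ y, |F y| ≤ A * Real.exp (c * |y|)) : Integrable F (gaussianReal 0 v) := by
  have h1 : Integrable (fun y : ℝ => Real.exp (c * |y|)) (gaussianReal 0 v) :=
    integrable_exp_mul_abs (X := fun y => y) (integrable_exp_mul_gaussianReal c)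
      (integrable_exp_mul_gaussianReal (-c))
  refine (h1.const_mul A).mono' hF.aestronglyMeasurable (ae_of_all _ fun y => ?_)
  rw [Real.norm_eq_abs]
  exact h y

theorem integral_sq_gaussianReal (v : ℝ≥0) : ∫ y, y ^ 2 ∂(gaussianReal 0 v) = v := by
  rw [← variance_fun_id_gaussianReal (μ := 0) (v := v),
    variance_of_integral_eq_zero aemeasurable_id' (by simp)]

theorem integrable_sq_gaussianReal (v : ℝ≥0) :
    Integrable (fun y : ℝ => y ^ 2) (gaussianReal 0 v) := by
  have := (memLp_id_gaussianReal' (μ := 0) (v := v) 2 (by simp)).integrable_sq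
  simpa using this

theorem integrable_gaussianReal_iff {v : ℝ≥0} (hv : v ≠ 0) {F : ℝ → ℝ} :
    Integrable F (gaussianReal 0 v) ↔ Integrable fun y => gaussianPDFReal 0 v y * F y := by
  rw [gaussianReal_of_var_ne_zero _ hv, integrable_withDensity_iff_integrable_smul'
    (measurable_gaussianPDF _ _) (ae_of_all _ fun _ => gaussianPDF_lt_top)]
  simp only [toReal_gaussianPDF, smul_eq_mul]

theorem hasDerivAt_gaussianPDFReal {v : ℝ≥0} (y : ℝ) :
    HasDerivAt (gaussianPDFReal 0 v) (-(y / v) * gaussianPDFReal 0 v y) y := by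
  have h1 : HasDerivAt (fun y : ℝ => -(y - 0) ^ 2 / (2 * v)) (-(y / v)) y := by
    have h := ((((hasDerivAt_id y).sub_const 0).pow 2).neg).div_const (2 * (v : ℝ))
    refine h.congr_deriv ?_
    simp only [id]
    norm_num
    rw [neg_div, mul_div_mul_left _ _ two_ne_zero]
  have h2 := (h1.exp).const_mul (√(2 * Real.pi * v))⁻¹
  rw [gaussianPDFReal_def]
  refine h2.congr_deriv ?_
  simp only []
  ring

theorem log_gaussianPDFReal {v : ℝ≥0} (hv : v ≠ 0) (y : ℝ) :
    Real.log (gaussianPDFReal 0 v y) = -(Real.log (2 * Real.pi * v) / 2) - y ^ 2 / (2 * v) := by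
  have hv' : (0 : ℝ) < v := by exact_mod_cast pos_iff_ne_zero.2 hv
  have hp : 0 < 2 * Real.pi * v := by positivity
  rw [gaussianPDFReal, Real.log_mul (by positivity) (Real.exp_ne_zero _), Real.log_inv,
    Real.log_sqrt hp.le, Real.log_exp]
  ring

/-- **Gaussian integration by parts** (Stein's identity). -/
theorem integral_mul_gaussianReal_eq {v : ℝ≥0} (hv : v ≠ 0) {u u' : ℝ → ℝ}
    (hu : ∀ y, HasDerivAt u (u' y) y) (hi : Integrable u (gaussianReal 0 v))
    (hi' : Integrable u' (gaussianReal 0 v))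
    (hyi : Integrable (fun y => y * u y) (gaussianReal 0 v)) :
    ∫ y, y * u y ∂(gaussianReal 0 v) = v * ∫ y, u' y ∂(gaussianReal 0 v) := by
  have hv' : (v : ℝ) ≠ 0 := by exact_mod_cast hv
  rw [integrable_gaussianReal_iff hv] at hi hi' hyi
  have h := integral_mul_deriv_eq_deriv_mul_of_integrable (u := u) (u' := u')
    (v := gaussianPDFReal 0 v) (v' := fun y => -(y / v) * gaussianPDFReal 0 v y)
    (fun y _ => hu y) (fun y _ => hasDerivAt_gaussianPDFReal y)
    (by
      refine (hyi.const_mul (-(v : ℝ)⁻¹)).congr (ae_of_all _ fun y => ?_)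
      simp only [Pi.mul_apply]; ring)
    (hi'.congr (ae_of_all _ fun y => by simp only [Pi.mul_apply]; ring))
    (hi.congr (ae_of_all _ fun y => by simp only [Pi.mul_apply]; ring))
  rw [integral_gaussianReal_eq_integral_smul hv, integral_gaussianReal_eq_integral_smul hv]
  simp only [smul_eq_mul]
  have h1 : ∫ y, u y * (-(y / v) * gaussianPDFReal 0 v y) =
      -(v : ℝ)⁻¹ * ∫ y, gaussianPDFReal 0 v y * (y * u y) := by
    rw [← integral_const_mul]; congr 1; funext y; ring
  have h2 : ∫ y, u' y * gaussianPDFReal 0 v y = ∫ y, gaussianPDFReal 0 v y * u' y := by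
    congr 1; funext y; ring
  rw [h1, h2] at h
  generalize ∫ y, gaussianPDFReal 0 v y * (y * u y) = I at h ⊢
  field_simp at h
  linarith

theorem integrable_gaussianReal_of_abs_le_linear {v : ℝ≥0} {L : ℝ → ℝ} (hL : Continuous L)
    {a C : ℝ} (hC : 0 ≤ C) (ha : ∀ y, |L y| ≤ a + C * |y|) : Integrable L (gaussianReal 0 v) := by
  have ha0 : 0 ≤ a := (abs_nonneg (L 0)).trans (by simpa using ha 0)
  refine integrable_gaussianReal_of_abs_le_exp hL (A := a + C) (c := 1) fun y => ?_
  have h1 := Real.add_one_le_exp |y|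
  have h2 : 1 ≤ Real.exp |y| := by linarith [abs_nonneg y]
  have h3 : |y| ≤ Real.exp |y| := by linarith
  rw [one_mul, add_mul]
  nlinarith [ha y, mul_le_mul_of_nonneg_left h2 ha0, mul_le_mul_of_nonneg_left h3 hC]

/-- Differentiation of `E[L(r Z)]` in the scale parameter `r`, for a standard Gaussian `Z`. The
derivative `E[Z L'(r Z)]` equals `r E[L''(r Z)]` by Gaussian integration by parts. -/
theorem hasDerivAt_integral_comp_mul_gaussianReal {L ℓ ℓ' : ℝ → ℝ} {C : ℝ}
    (hL : ∀ y, HasDerivAt L (ℓ y) y) (hℓ : ∀ y, HasDerivAt ℓ (ℓ' y) y)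
    (hC : ∀ y, |ℓ y| ≤ C) {r : ℝ}
    (hi' : Integrable (fun z => ℓ' (r * z)) (gaussianReal 0 1)) :
    HasDerivAt (fun r => ∫ z, L (r * z) ∂(gaussianReal 0 1))
      (r * ∫ z, ℓ' (r * z) ∂(gaussianReal 0 1)) r := by
  have hLc : Continuous L := continuous_iff_continuousAt.2 fun y => (hL y).continuousAt
  have hℓc : Continuous ℓ := continuous_iff_continuousAt.2 fun y => (hℓ y).continuousAt
  have hC0 : 0 ≤ C := (abs_nonneg _).trans (hC 0)
  have hid : Integrable (fun z : ℝ => z) (gaussianReal 0 1) :=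
    (memLp_id_gaussianReal' (μ := 0) (v := 1) 1 (by simp)).integrable le_rfl
  have hlin := abs_le_add_mul_abs_of_hasDerivAt hL hC
  have hint : Integrable (fun z => L (r * z)) (gaussianReal 0 1) := by
    refine integrable_gaussianReal_of_abs_le_linear (a := |L 0|) (C := C * |r|) (by fun_prop)
      (by positivity) fun y => ?_
    have := hlin (r * y)
    rwa [abs_mul, ← mul_assoc] at this
  have hd := hasDerivAt_integral_of_dominated_loc_of_deriv_le (μ := gaussianReal 0 1)
    (F := fun r z => L (r * z)) (F' := fun r z => z * ℓ (r * z)) (x₀ := r) (s := Set.univ)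
    (bound := fun z => C * |z|) univ_mem
    (Eventually.of_forall fun x => Continuous.aestronglyMeasurable (by fun_prop)) hint
    (Continuous.aestronglyMeasurable (by fun_prop))
    (ae_of_all _ fun z x _ => by
      rw [norm_mul, Real.norm_eq_abs, Real.norm_eq_abs, mul_comm]
      exact mul_le_mul_of_nonneg_right (hC _) (abs_nonneg _))
    (hid.abs.const_mul C)
    (ae_of_all _ fun z x _ => by
      have h1 : HasDerivAt (fun x : ℝ => x * z) z x := by simpa using (hasDerivAt_id x).mul_const z
      have h2 := (hL (x * z)).comp x h1
      rw [mul_comm] at h2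
      exact h2)
  have hstein := integral_mul_gaussianReal_eq (v := 1) one_ne_zero (u := fun z => ℓ (r * z))
    (u' := fun z => r * ℓ' (r * z))
    (fun z => by
      have h1 : HasDerivAt (fun x : ℝ => r * x) r z := by simpa using (hasDerivAt_id z).const_mul r
      have h2 := (hℓ (r * z)).comp z h1
      rw [mul_comm] at h2
      exact h2)
    (integrable_gaussianReal_of_abs_le_linear (a := C) (C := 0) (by fun_prop) le_rfl fun y => by
      simpa using hC (r * y))
    (hi'.const_mul r) hd.1
  refine hd.2.congr_deriv ?_
  rw [hstein, integral_const_mul]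
  simp

/-! ### The density of a function of a Gaussian variable that solves `f' = σ(f)` -/

section Density

variable {σ f : ℝ → ℝ} {v : ℝ≥0}

/-- The density of `f(Z)` for `Z` centered Gaussian with variance `v`, where `f' = σ(f)`: it
vanishes outside the range of `f`. -/
noncomputable def flowDensity (σ f : ℝ → ℝ) (v : ℝ≥0) : ℝ → ℝ :=
  Function.extend f (fun y => gaussianPDFReal 0 v y / |σ (f y)|) 0

theorem isOpenEmbedding_flow (hσ : ContDiff ℝ (⊤ : ℕ∞) σ) (hf : ∀ y, HasDerivAt f (σ (f y)) y)
    (h : ∀ y, σ (f y) ≠ 0) : IsOpenEmbedding f := by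
  have hfc : Continuous f := continuous_iff_continuousAt.2 fun y => (hf y).continuousAt
  exact isOpenEmbedding_of_hasStrictDerivAt (fun y =>
    hasStrictDerivAt_of_hasDerivAt_of_continuousAt (Eventually.of_forall hf)
      (hσ.continuous.comp hfc).continuousAt) h

theorem flowDensity_apply (hf : Function.Injective f) (y : ℝ) :
    flowDensity σ f v (f y) = gaussianPDFReal 0 v y / |σ (f y)| :=
  hf.extend_apply _ _ _

theorem flowDensity_of_notMem {x : ℝ} (hx : x ∉ Set.range f) : flowDensity σ f v x = 0 :=
  Function.extend_apply' _ _ _ hx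

/-- Change of variables: `flowDensity σ f v` is a density of the image measure under `f`. -/
theorem gaussianReal_map_flow (hv : v ≠ 0) (hσ : ContDiff ℝ (⊤ : ℕ∞) σ)
    (hf : ∀ y, HasDerivAt f (σ (f y)) y) (h : ∀ y, σ (f y) ≠ 0) :
    (gaussianReal 0 v).map f =
      volume.withDensity fun x => ENNReal.ofReal (flowDensity σ f v x) := by
  rw [flowDensity, ← map_withDensity_eq_withDensity_extend (isOpenEmbedding_flow hσ hf h) hf,
    gaussianReal_of_var_ne_zero _ hv]
  congr 2
  funext y
  rw [gaussianPDF_def, mul_div_cancel₀ _ (abs_ne_zero.2 (h y))]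

theorem log_gaussianPDFReal_div_speed (hv : v ≠ 0) {y : ℝ} (h : σ (f y) ≠ 0) :
    Real.log (gaussianPDFReal 0 v y / |σ (f y)|) =
      -(Real.log (2 * Real.pi * v) / 2) - y ^ 2 / (2 * v) - logSpeed σ f y := by
  rw [Real.log_div (gaussianPDFReal_pos _ _ _ hv).ne' (abs_ne_zero.2 h), log_gaussianPDFReal hv,
    Real.log_abs, logSpeed]

/-- This is what makes the density continuous at the end points of the range of `f`. -/
theorem tendsto_gaussianPDFReal_div_speed (hv : v ≠ 0) (hσ : ContDiff ℝ (⊤ : ℕ∞) σ)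
    (hf : ∀ y, HasDerivAt f (σ (f y)) y) (h : ∀ y, σ (f y) ≠ 0) {C : ℝ}
    (hC : ∀ x, |deriv σ x| ≤ C) :
    Tendsto (fun y => gaussianPDFReal 0 v y / |σ (f y)|) (cocompact ℝ) (𝓝 0) := by
  have hv' : (0 : ℝ) < v := by exact_mod_cast pos_iff_ne_zero.2 hv
  -- the speed is at least of the order `exp (-C |y|)`, which the Gaussian density beats
  set a := -(Real.log (2 * Real.pi * v) / 2) + |logSpeed σ f 0|
  have h1 : Tendsto (fun r : ℝ => a + r * (C + -(1 / (2 * v)) * r)) atTop atBot := by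
    refine tendsto_atBot_add_const_left _ _ (tendsto_id.atTop_mul_atBot₀ ?_)
    exact tendsto_atBot_add_const_left _ _
      (tendsto_id.const_mul_atTop_of_neg (neg_lt_zero.2 (by positivity)))
  have h2 : Tendsto (fun y : ℝ => Real.exp (a + |y| * (C + -(1 / (2 * v)) * |y|)))
      (cocompact ℝ) (𝓝 0) :=
    Real.tendsto_exp_atBot.comp (h1.comp tendsto_norm_cocompact_atTop)
  refine squeeze_zero (fun y => div_nonneg (gaussianPDFReal_nonneg _ _ _) (abs_nonneg _))
    (fun y => ?_) h2
  rw [← Real.log_le_iff_le_exp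
    (div_pos (gaussianPDFReal_pos _ _ _ hv) (abs_pos.2 (h y))), log_gaussianPDFReal_div_speed hv
    (h y)]
  have h3 := neg_le_of_abs_le (abs_logSpeed_le hσ hf h hC y)
  have h4 : |y| * (-(1 / (2 * v)) * |y|) = -(y ^ 2 / (2 * v)) := by
    rw [← sq_abs y]; ring
  have ha : a = -(Real.log (2 * Real.pi * v) / 2) + |logSpeed σ f 0| := rfl
  rw [mul_add, h4, ha]
  linarith

theorem hasDerivAt_gaussianPDFReal_div_speed (hσ : ContDiff ℝ (⊤ : ℕ∞) σ)
    (hf : ∀ y, HasDerivAt f (σ (f y)) y) (h : ∀ y, σ (f y) ≠ 0) (y : ℝ) :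
    HasDerivAt (fun y => gaussianPDFReal 0 v y / |σ (f y)|)
      (-(y / v + deriv σ (f y)) * (gaussianPDFReal 0 v y / |σ (f y)|)) y := by
  have h1 : HasDerivAt (fun y => gaussianPDFReal 0 v y * Real.exp (-logSpeed σ f y))
      (-(y / v) * gaussianPDFReal 0 v y * Real.exp (-logSpeed σ f y) +
        gaussianPDFReal 0 v y * (Real.exp (-logSpeed σ f y) * -deriv σ (f y))) y :=
    (hasDerivAt_gaussianPDFReal (v := v) y).mul (hasDerivAt_logSpeed hσ hf (h y)).neg.exp
  have h2 : ∀ y, Real.exp (-logSpeed σ f y) = |σ (f y)|⁻¹ := fun y => by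
    rw [Real.exp_neg, exp_logSpeed (h y)]
  simp only [h2, ← div_eq_mul_inv] at h1
  refine h1.congr_deriv ?_
  ring

theorem hasDerivAt_flowDensity (hσ : ContDiff ℝ (⊤ : ℕ∞) σ)
    (hf : ∀ y, HasDerivAt f (σ (f y)) y) (h : ∀ y, σ (f y) ≠ 0) (y : ℝ) :
    HasDerivAt (flowDensity σ f v)
      (-(y / v + deriv σ (f y)) * (gaussianPDFReal 0 v y / |σ (f y)|) / σ (f y)) (f y) :=
  hasDerivAt_extend (isOpenEmbedding_flow hσ hf h) (hf y) (h y)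
    (hasDerivAt_gaussianPDFReal_div_speed hσ hf h y) (by rw [div_mul_cancel₀ _ (h y)])

/-- The score `∂ₓ log p` of the density at `f(y)` is `-(y / v + σ'(f(y))) / σ(f(y))`, so that the
weight `σ²` in the Fisher information cancels the speed. -/
theorem fisherIntegrand_flowDensity (hv : v ≠ 0) (hσ : ContDiff ℝ (⊤ : ℕ∞) σ)
    (hf : ∀ y, HasDerivAt f (σ (f y)) y) (h : ∀ y, σ (f y) ≠ 0) (y : ℝ) :
    fisherIntegrand (fun x => σ x ^ 2) (flowDensity σ f v) (f y) =
      (y / v + deriv σ (f y)) ^ 2 := by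
  have hpos : 0 < gaussianPDFReal 0 v y / |σ (f y)| :=
    div_pos (gaussianPDFReal_pos _ _ _ hv) (abs_pos.2 (h y))
  have hy := flowDensity_apply (σ := σ) (v := v) (isOpenEmbedding_flow hσ hf h).injective y
  have hd := (hasDerivAt_flowDensity (v := v) hσ hf h y).log (by rw [hy]; exact hpos.ne')
  rw [fisherIntegrand, hd.deriv, hy, mul_div_right_comm, mul_div_cancel_right₀ _ hpos.ne', div_pow,
    mul_div_cancel₀ _ (pow_ne_zero 2 (h y))]
  ring

theorem isRegularDensity_flowDensity {Ω : Type*} [MeasurableSpace Ω] {P : Measure Ω}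
    (hv : v ≠ 0) (hσ : ContDiff ℝ (⊤ : ℕ∞) σ)
    (hf : ∀ y, HasDerivAt f (σ (f y)) y) (h : ∀ y, σ (f y) ≠ 0) {C : ℝ}
    (hC : ∀ x, |deriv σ x| ≤ C) {Z Y : Ω → ℝ} (hZm : AEMeasurable Z P)
    (hZ : P.map Z = gaussianReal 0 v) (hY : ∀ᵐ ω ∂P, Y ω = f (Z ω)) :
    IsRegularDensity P Y (flowDensity σ f v) where
  aemeasurable := (((isOpenEmbedding_flow hσ hf h).continuous.measurable.comp_aemeasurable
    hZm).congr (hY.mono fun _ hω => hω.symm))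
  continuous := (isOpenEmbedding_flow hσ hf h).continuous_extend_zero
    (continuous_iff_continuousAt.2 fun y =>
      (hasDerivAt_gaussianPDFReal_div_speed hσ hf h y).continuousAt)
    (tendsto_gaussianPDFReal_div_speed hv hσ hf h hC)
  nonneg x := by
    by_cases hx : x ∈ Set.range f
    · obtain ⟨y, rfl⟩ := hx
      rw [flowDensity_apply (isOpenEmbedding_flow hσ hf h).injective]
      exact div_nonneg (gaussianPDFReal_nonneg _ _ _) (abs_nonneg _)
    · rw [flowDensity_of_notMem hx]
  law := by
    rw [Measure.map_congr hY, ← gaussianReal_map_flow hv hσ hf h, ← hZ,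
      AEMeasurable.map_map_of_aemeasurable
        (isOpenEmbedding_flow hσ hf h).continuous.measurable.aemeasurable hZm]
    rfl
  differentiableAt x hx := by
    by_cases hr : x ∈ Set.range f
    · obtain ⟨y, rfl⟩ := hr
      exact (hasDerivAt_flowDensity hσ hf h y).differentiableAt
    · rw [flowDensity_of_notMem hr] at hx
      exact absurd hx (lt_irrefl _)

/-! ### The entropy and its derivative -/

theorem speed_mul_flowDensity_mul_log (hv : v ≠ 0) (hσ : ContDiff ℝ (⊤ : ℕ∞) σ)
    (hf : ∀ y, HasDerivAt f (σ (f y)) y) (h : ∀ y, σ (f y) ≠ 0) (y : ℝ) :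
    |σ (f y)| * (flowDensity σ f v (f y) * Real.log (flowDensity σ f v (f y))) =
      gaussianPDFReal 0 v y *
        (-(Real.log (2 * Real.pi * v) / 2) - y ^ 2 / (2 * v) - logSpeed σ f y) := by
  rw [flowDensity_apply (isOpenEmbedding_flow hσ hf h).injective,
    log_gaussianPDFReal_div_speed hv (h y), ← mul_assoc,
    mul_div_cancel₀ _ (abs_ne_zero.2 (h y))]

theorem flowDensity_mul_log_of_notMem {x : ℝ} (hx : x ∉ Set.range f) :
    flowDensity σ f v x * Real.log (flowDensity σ f v x) = 0 := by
  rw [flowDensity_of_notMem hx, zero_mul]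

theorem continuous_logSpeed (hσ : ContDiff ℝ (⊤ : ℕ∞) σ)
    (hf : ∀ y, HasDerivAt f (σ (f y)) y) (h : ∀ y, σ (f y) ≠ 0) : Continuous (logSpeed σ f) :=
  continuous_iff_continuousAt.2 fun y => (hasDerivAt_logSpeed hσ hf (h y)).continuousAt

theorem integrable_logSpeed (hσ : ContDiff ℝ (⊤ : ℕ∞) σ)
    (hf : ∀ y, HasDerivAt f (σ (f y)) y) (h : ∀ y, σ (f y) ≠ 0) {C : ℝ}
    (hC : ∀ x, |deriv σ x| ≤ C) : Integrable (logSpeed σ f) (gaussianReal 0 v) :=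
  integrable_gaussianReal_of_abs_le_linear (continuous_logSpeed hσ hf h)
    ((abs_nonneg _).trans (hC 0)) (abs_logSpeed_le hσ hf h hC)

theorem integrable_flowDensity_mul_log (hv : v ≠ 0) (hσ : ContDiff ℝ (⊤ : ℕ∞) σ)
    (hf : ∀ y, HasDerivAt f (σ (f y)) y) (h : ∀ y, σ (f y) ≠ 0) {C : ℝ}
    (hC : ∀ x, |deriv σ x| ≤ C) :
    Integrable fun x => flowDensity σ f v x * Real.log (flowDensity σ f v x) := by
  rw [integrable_iff_integrable_comp_of_eq_zero (isOpenEmbedding_flow hσ hf h) hf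
    fun x => flowDensity_mul_log_of_notMem]
  simp only [speed_mul_flowDensity_mul_log hv hσ hf h]
  rw [← integrable_gaussianReal_iff hv]
  exact ((integrable_const _).sub ((integrable_sq_gaussianReal v).div_const _)).sub
    (integrable_logSpeed hσ hf h hC)

/-- The entropy of `f(Z)` is the entropy of the Gaussian variable `Z` plus the expectation of
`log |f'(Z)|`. -/
theorem shannonEntropy_flowDensity (hv : v ≠ 0) (hσ : ContDiff ℝ (⊤ : ℕ∞) σ)
    (hf : ∀ y, HasDerivAt f (σ (f y)) y) (h : ∀ y, σ (f y) ≠ 0) {C : ℝ}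
    (hC : ∀ x, |deriv σ x| ≤ C) :
    shannonEntropy (flowDensity σ f v) =
      Real.log (2 * Real.pi * v) / 2 + 1 / 2 + ∫ y, logSpeed σ f y ∂(gaussianReal 0 v) := by
  have hv' : (v : ℝ) ≠ 0 := by exact_mod_cast hv
  rw [shannonEntropy, integral_eq_integral_comp_of_eq_zero (isOpenEmbedding_flow hσ hf h) hf
    fun x => flowDensity_mul_log_of_notMem]
  simp only [speed_mul_flowDensity_mul_log hv hσ hf h]
  have h1 := integral_gaussianReal_eq_integral_smul (μ := 0) hv (f := fun y : ℝ =>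
    -(Real.log (2 * Real.pi * v) / 2) - y ^ 2 / (2 * v) - logSpeed σ f y)
  simp only [smul_eq_mul] at h1
  have hi : Integrable (fun y : ℝ => y ^ 2 / (2 * (v : ℝ))) (gaussianReal 0 v) :=
    (integrable_sq_gaussianReal v).div_const _
  have hi2 : Integrable (fun y : ℝ => -(Real.log (2 * Real.pi * v) / 2) - y ^ 2 / (2 * (v : ℝ)))
      (gaussianReal 0 v) := (integrable_const _).sub hi
  rw [← h1, integral_sub hi2 (integrable_logSpeed hσ hf h hC),
    integral_sub (integrable_const _) hi, integral_div, integral_sq_gaussianReal]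
  simp only [integral_const, probReal_univ, one_smul]
  field_simp
  ring

theorem hasDerivAt_deriv_of_contDiff (hσ : ContDiff ℝ (⊤ : ℕ∞) σ) (x : ℝ) :
    HasDerivAt (deriv σ) (iteratedDeriv 2 σ x) x := by
  have h2 := hσ.differentiable_iteratedDeriv 1 (by exact_mod_cast ENat.natCast_lt_top 1)
  rw [iteratedDeriv_succ, ← iteratedDeriv_one]
  exact (h2 x).hasDerivAt

theorem hasDerivAt_deriv_comp_flow (hσ : ContDiff ℝ (⊤ : ℕ∞) σ)
    (hf : ∀ y, HasDerivAt f (σ (f y)) y) (y : ℝ) :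
    HasDerivAt (fun y => deriv σ (f y)) (iteratedDeriv 2 σ (f y) * σ (f y)) y :=
  (hasDerivAt_deriv_of_contDiff hσ (f y)).comp y (hf y)

theorem abs_iteratedDeriv_mul_speed_le (hσ : ContDiff ℝ (⊤ : ℕ∞) σ)
    (hf : ∀ y, HasDerivAt f (σ (f y)) y) (h : ∀ y, σ (f y) ≠ 0) {C D : ℝ}
    (hC : ∀ x, |deriv σ x| ≤ C) (hD : ∀ x, |iteratedDeriv 2 σ x| ≤ D) (y : ℝ) :
    |iteratedDeriv 2 σ (f y) * σ (f y)| ≤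
      D * Real.exp |logSpeed σ f 0| * Real.exp (C * |y|) := by
  have hD0 : 0 ≤ D := (abs_nonneg _).trans (hD 0)
  rw [abs_mul, ← exp_logSpeed (h y), mul_assoc, ← Real.exp_add]
  gcongr
  · exact hD _
  · exact (le_abs_self _).trans (abs_logSpeed_le hσ hf h hC y)

/-- Along the variance `t ^ (2H)`, the entropy has derivative
`H / t + H t ^ (2H - 1) E[σ''(f(Z)) σ(f(Z))]`. -/
theorem hasDerivAt_shannonEntropy_flowDensity (hσ : ContDiff ℝ (⊤ : ℕ∞) σ)
    (hf : ∀ y, HasDerivAt f (σ (f y)) y) (h : ∀ y, σ (f y) ≠ 0) {C D : ℝ}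
    (hC : ∀ x, |deriv σ x| ≤ C) (hD : ∀ x, |iteratedDeriv 2 σ x| ≤ D) (H : ℝ) {t : ℝ≥0}
    (ht : 0 < t) :
    HasDerivAt (fun s : ℝ => shannonEntropy (flowDensity σ f (s.toNNReal ^ (2 * H))))
      (H * (t : ℝ) ^ (2 * H - 1) * (1 / (t : ℝ) ^ (2 * H) +
        ∫ y, iteratedDeriv 2 σ (f y) * σ (f y) ∂(gaussianReal 0 (t ^ (2 * H))))) t := by
  have ht' : (0 : ℝ) < t := ht
  have hfc : Continuous f := continuous_iff_continuousAt.2 fun y => (hf y).continuousAt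
  have hc2 : Continuous (iteratedDeriv 2 σ) :=
    hσ.continuous_iteratedDeriv 2 (WithTop.coe_le_coe.2 le_top)
  have hc3 : Continuous fun y => iteratedDeriv 2 σ (f y) * σ (f y) :=
    (hc2.comp hfc).mul (hσ.continuous.comp hfc)
  -- the Gaussian law of variance `s ^ (2H)` is the standard one scaled by `s ^ H`
  have hpow : ∀ s : ℝ, 0 < s → (s ^ H) ^ 2 = ((s.toNNReal ^ (2 * H) : ℝ≥0) : ℝ) := by
    intro s hs
    rw [NNReal.coe_rpow, Real.coe_toNNReal _ hs.le, ← Real.rpow_natCast, ← Real.rpow_mul hs.le]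
    congr 1; push_cast; ring
  have hform : ∀ s : ℝ, 0 < s → shannonEntropy (flowDensity σ f (s.toNNReal ^ (2 * H))) =
      (Real.log (2 * Real.pi) / 2 + H * Real.log s + 1 / 2) +
        ∫ z, logSpeed σ f (s ^ H * z) ∂(gaussianReal 0 1) := by
    intro s hs
    have hs' : s.toNNReal ^ (2 * H) ≠ 0 := (NNReal.rpow_pos (Real.toNNReal_pos.2 hs)).ne'
    rw [shannonEntropy_flowDensity hs' hσ hf h hC, NNReal.coe_rpow, Real.coe_toNNReal _ hs.le,
      Real.log_mul (by positivity) (by positivity), Real.log_rpow hs,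
      gaussianReal_zero_eq_map_mul (hpow s hs),
      integral_map (by fun_prop) (continuous_logSpeed hσ hf h).aestronglyMeasurable]
    ring
  have hi' : Integrable (fun z => iteratedDeriv 2 σ (f ((t : ℝ) ^ H * z)) *
      σ (f ((t : ℝ) ^ H * z))) (gaussianReal 0 1) := by
    refine integrable_gaussianReal_of_abs_le_exp (A := D * Real.exp |logSpeed σ f 0|)
      (c := C * (t : ℝ) ^ H) (hc3.comp (by fun_prop)) fun z => ?_
    have := abs_iteratedDeriv_mul_speed_le hσ hf h hC hD ((t : ℝ) ^ H * z)
    rwa [abs_mul ((t : ℝ) ^ H), abs_of_nonneg (by positivity : (0 : ℝ) ≤ (t : ℝ) ^ H),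
      ← mul_assoc C] at this
  have hE := hasDerivAt_integral_comp_mul_gaussianReal (r := (t : ℝ) ^ H)
    (fun y => hasDerivAt_logSpeed hσ hf (h y)) (hasDerivAt_deriv_comp_flow hσ hf)
    (fun y => hC (f y)) hi'
  have hd := ((((Real.hasDerivAt_log ht'.ne').const_mul H).const_add
    (Real.log (2 * Real.pi) / 2)).add_const (1 / 2 : ℝ)).add
    (hE.comp (t : ℝ) (Real.hasDerivAt_rpow_const (p := H) (Or.inl ht'.ne')))
  have hI : ∫ z, iteratedDeriv 2 σ (f ((t : ℝ) ^ H * z)) * σ (f ((t : ℝ) ^ H * z))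
      ∂(gaussianReal 0 1) =
      ∫ y, iteratedDeriv 2 σ (f y) * σ (f y) ∂(gaussianReal 0 (t ^ (2 * H))) := by
    have h1 := hpow t ht'
    rw [Real.toNNReal_coe] at h1
    rw [gaussianReal_zero_eq_map_mul h1, integral_map (by fun_prop) hc3.aestronglyMeasurable]
  rw [hI] at hd
  refine (hd.congr_of_eventuallyEq ?_).congr_deriv ?_
  · filter_upwards [lt_mem_nhds ht'] with s hs
    exact hform s hs
  · have e1 : (t : ℝ) ^ (2 * H - 1) = (t : ℝ) ^ (2 * H) / t := Real.rpow_sub_one ht'.ne' _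
    have e2 : (t : ℝ) ^ (H - 1) = (t : ℝ) ^ H / t := Real.rpow_sub_one ht'.ne' _
    have e3 : (t : ℝ) ^ (2 * H) = (t : ℝ) ^ H * (t : ℝ) ^ H := by
      rw [← Real.rpow_add ht']; congr 1; ring
    have e4 : (t : ℝ) ^ H ≠ 0 := (Real.rpow_pos_of_pos ht' _).ne'
    rw [e1, e2, e3]
    field_simp

end Density

/-! ### The generalized de Bruijn identity -/

theorem iteratedDeriv_two_sq {σ : ℝ → ℝ} (hσ : ContDiff ℝ (⊤ : ℕ∞) σ) (x : ℝ) :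
    iteratedDeriv 2 (fun x => σ x ^ 2) x =
      2 * (iteratedDeriv 2 σ x * σ x + deriv σ x ^ 2) := by
  have hd : ∀ x, HasDerivAt σ (deriv σ x) x := fun x =>
    (hσ.differentiable (by simp) x).hasDerivAt
  have h1 : deriv (fun x => σ x ^ 2) = fun x => 2 * (σ x * deriv σ x) := by
    funext x
    rw [((hd x).fun_pow 2).deriv]
    push_cast
    ring
  have h3 := (((hd x).mul (hasDerivAt_deriv_of_contDiff hσ x)).const_mul 2).deriv
  rw [iteratedDeriv_succ, iteratedDeriv_one, h1]
  refine h3.trans ?_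
  ring

section Transfer

variable {Ω : Type*} [MeasurableSpace Ω] {P : Measure Ω} {γ : Measure ℝ} {Z Y : Ω → ℝ}
  {f F k : ℝ → ℝ}

theorem integrable_comp_of_law (hZm : AEMeasurable Z P) (hZ : P.map Z = γ)
    (hY : ∀ᵐ ω ∂P, Y ω = f (Z ω)) (hk : ∀ y, F (f y) = k y) (hi : Integrable k γ) :
    Integrable (fun ω => F (Y ω)) P := by
  subst hZ
  refine (hi.comp_aemeasurable hZm).congr ?_
  filter_upwards [hY] with ω hω
  rw [hω, hk]; rfl

theorem integral_comp_of_law (hZm : AEMeasurable Z P) (hZ : P.map Z = γ)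
    (hY : ∀ᵐ ω ∂P, Y ω = f (Z ω)) (hk : ∀ y, F (f y) = k y) (hi : Integrable k γ) :
    ∫ ω, F (Y ω) ∂P = ∫ y, k y ∂γ := by
  subst hZ
  rw [integral_map hZm hi.aestronglyMeasurable]
  refine integral_congr_ae ?_
  filter_upwards [hY] with ω hω
  rw [hω, hk]

end Transfer

theorem theorem2p1 {Ω : Type*} [MeasurableSpace Ω] (P : Measure Ω) [IsProbabilityMeasure P]
    (H : ℝ) (hH0 : 0 < H) (hH1 : H < 1)
    (B : ℝ≥0 → Ω → ℝ) (hB : IsFBM P H B)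
    (σ : ℝ → ℝ) (hσ : ContDiff ℝ (⊤ : ℕ∞) σ)
    (hσ_bdd : ∀ n : ℕ, 1 ≤ n → ∃ C : ℝ, ∀ x, |iteratedDeriv n σ x| ≤ C)
    (x₀ : ℝ) (hx₀ : σ x₀ ≠ 0)
    (X : ℝ≥0 → Ω → ℝ) (hX : IsPathwiseSolution P H B σ x₀ X) :
    ∃ p : ℝ≥0 → ℝ → ℝ,
      (∀ t : ℝ≥0, 0 < t → IsRegularDensity P (X t) (p t)) ∧
      ∀ t : ℝ≥0, 0 < t →
        Integrable (fun x => p t x * Real.log (p t x)) ∧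
        Integrable (fun ω => fisherIntegrand (fun x => σ x ^ 2) (p t) (X t ω)) P ∧
        Integrable (fun ω => iteratedDeriv 2 (fun x => σ x ^ 2) (X t ω)) P ∧
        Integrable (fun ω => iteratedDeriv 2 σ (X t ω) * σ (X t ω) + deriv σ (X t ω) ^ 2) P ∧
        HasDerivAt (fun s : ℝ => shannonEntropy (p s.toNNReal))
          (H * (t : ℝ) ^ (2 * H - 1) *
            (fisherInformation P (fun x => σ x ^ 2) (X t) (p t)
              - ∫ ω, iteratedDeriv 2 (fun x => σ x ^ 2) (X t ω) ∂P
              + ∫ ω, (iteratedDeriv 2 σ (X t ω) * σ (X t ω) + deriv σ (X t ω) ^ 2) ∂P))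
          (t : ℝ) := by
  obtain ⟨f, hf0, hf, hXf⟩ := hX.exists_flow hB hH0 hσ
  obtain ⟨C, hC⟩ := hσ_bdd 1 le_rfl
  rw [iteratedDeriv_one] at hC
  obtain ⟨D, hD⟩ := hσ_bdd 2 one_le_two
  have h : ∀ y, σ (f y) ≠ 0 := speed_ne_zero hσ hf (by rwa [hf0])
  have hfc : Continuous f := continuous_iff_continuousAt.2 fun y => (hf y).continuousAt
  have hm : ∀ t, AEMeasurable (B t) P := hB.gaussian.aemeasurable
  have hv0 : ∀ t : ℝ≥0, 0 < t → t ^ (2 * H) ≠ 0 := fun t ht => (NNReal.rpow_pos ht).ne'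
  refine ⟨fun t => flowDensity σ f (t ^ (2 * H)), fun t ht =>
    isRegularDensity_flowDensity (hv0 t ht) hσ hf h hC (hm t) (hB.map_eq hH0 t) (hXf t),
    fun t ht => ?_⟩
  have hv := hv0 t ht
  have hlaw := hB.map_eq hH0 t
  set v : ℝ≥0 := t ^ (2 * H) with hvdef
  have hv' : (v : ℝ) ≠ 0 := by exact_mod_cast hv
  -- `ℓ` is the derivative of the logarithm of the speed, `ℓ'` the second derivative
  set ℓ : ℝ → ℝ := fun y => deriv σ (f y) with hℓ
  set ℓ' : ℝ → ℝ := fun y => iteratedDeriv 2 σ (f y) * σ (f y) with hℓ'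
  have hℓd : ∀ y, HasDerivAt ℓ (ℓ' y) y := hasDerivAt_deriv_comp_flow hσ hf
  have hℓc : Continuous ℓ := continuous_iff_continuousAt.2 fun y => (hℓd y).continuousAt
  have hℓ'c : Continuous ℓ' := ((hσ.continuous_iteratedDeriv 2
    (WithTop.coe_le_coe.2 le_top)).comp hfc).mul (hσ.continuous.comp hfc)
  have hℓC : ∀ y, |ℓ y| ≤ C := fun y => hC _
  have hC0 : 0 ≤ C := (abs_nonneg _).trans (hC 0)
  have iℓ' : Integrable ℓ' (gaussianReal 0 v) :=
    integrable_gaussianReal_of_abs_le_exp hℓ'c (abs_iteratedDeriv_mul_speed_le hσ hf h hC hD)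
  have iℓ : Integrable ℓ (gaussianReal 0 v) :=
    integrable_gaussianReal_of_abs_le_linear (a := C) hℓc le_rfl fun y => by simpa using hℓC y
  have iℓ2 : Integrable (fun y => ℓ y ^ 2) (gaussianReal 0 v) :=
    integrable_gaussianReal_of_abs_le_linear (a := C ^ 2) (by fun_prop) le_rfl fun y => by
      rw [zero_mul, add_zero, abs_pow]
      exact pow_le_pow_left₀ (abs_nonneg _) (hℓC y) 2
  have iyℓ : Integrable (fun y => y * ℓ y) (gaussianReal 0 v) :=
    integrable_gaussianReal_of_abs_le_linear (a := 0) (C := C) (by fun_prop) hC0 fun y => by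
      rw [zero_add, abs_mul, mul_comm]
      exact mul_le_mul_of_nonneg_right (hℓC y) (abs_nonneg _)
  have isum : Integrable (fun y => ℓ' y + ℓ y ^ 2) (gaussianReal 0 v) := iℓ'.add iℓ2
  have hsq : (fun y : ℝ => (y / v + ℓ y) ^ 2) =
      fun y : ℝ => y ^ 2 / (v : ℝ) ^ 2 + 2 / v * (y * ℓ y) + ℓ y ^ 2 := by
    funext y; ring
  have i1 : Integrable (fun y : ℝ => y ^ 2 / (v : ℝ) ^ 2) (gaussianReal 0 v) :=
    (integrable_sq_gaussianReal v).div_const _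
  have i2 : Integrable (fun y : ℝ => y ^ 2 / (v : ℝ) ^ 2 + 2 / v * (y * ℓ y))
      (gaussianReal 0 v) := i1.add (iyℓ.const_mul _)
  have iJ : Integrable (fun y : ℝ => (y / v + ℓ y) ^ 2) (gaussianReal 0 v) := by
    rw [hsq]; exact i2.add iℓ2
  have hJ : ∫ y, (y / v + ℓ y) ^ 2 ∂(gaussianReal 0 v) =
      1 / v + 2 * (∫ y, ℓ' y ∂(gaussianReal 0 v)) + ∫ y, ℓ y ^ 2 ∂(gaussianReal 0 v) := by
    rw [hsq, integral_add i2 iℓ2, integral_add i1 (iyℓ.const_mul _), integral_div,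
      integral_const_mul, integral_sq_gaussianReal, integral_mul_gaussianReal_eq hv hℓd iℓ iℓ' iyℓ]
    field_simp
  have hF := fisherIntegrand_flowDensity hv hσ hf h
  have hS : ∀ y, iteratedDeriv 2 (fun x => σ x ^ 2) (f y) = 2 * (ℓ' y + ℓ y ^ 2) := fun y =>
    iteratedDeriv_two_sq hσ (f y)
  refine ⟨integrable_flowDensity_mul_log hv hσ hf h hC,
    integrable_comp_of_law (hm t) hlaw (hXf t) hF iJ,
    integrable_comp_of_law (hm t) hlaw (hXf t) hS (isum.const_mul 2),
    integrable_comp_of_law (F := fun x => iteratedDeriv 2 σ x * σ x + deriv σ x ^ 2)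
      (hm t) hlaw (hXf t) (fun _ => rfl) isum, ?_⟩
  refine (hasDerivAt_shannonEntropy_flowDensity hσ hf h hC hD H ht).congr_deriv ?_
  rw [fisherInformation, integral_comp_of_law (hm t) hlaw (hXf t) hF iJ,
    integral_comp_of_law (hm t) hlaw (hXf t) hS (isum.const_mul 2),
    integral_comp_of_law (F := fun x => iteratedDeriv 2 σ x * σ x + deriv σ x ^ 2)
      (hm t) hlaw (hXf t) (fun _ => rfl) isum, hJ, integral_const_mul, integral_add iℓ' iℓ2,
    show (t : ℝ) ^ (2 * H) = v from (NNReal.coe_rpow t _).symm]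
  simp only [hℓ']
  ring
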